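/- **Theorem.** Let $d\ge 2$ and let $\mathbb B^d$ be the closed unit ball of $\mathbb R^d$. Let $\phi:\mathbb R\to\mathbb R$ be infinitely differentiable with $|\phi|\le 1$ and $|\phi'|\le 1$ on $\mathbb R$, such that for some $\theta_0\in\mathbb R$ one has $\phi^{(j)}(\theta_0)\ne 0$ for all $j=0,1,2,\dots$, and such that $|\phi(-t)|=\mathcal O(t^{-1})$ and $|1-\phi(t)|=\mathcal O(t^{-1})$ as $t\to\infty$. Let $c_0>0$, $r=s+v$ with $s\in\{0,1,2,\dots\}$ and $0<v\le 1$, let $\mathcal R\ge 1$, and put $$\alpha=48\bigl(3+r(r+1)+7r(r+1)(s+1)!\bigr).$$ *Targets.* Let $Lip^{(\diamond,r,c_0)}$ be the set of functions $f(x)=g(|x|^2)$ on $\mathbb B^d$, where $g:[0,1]\to\mathbb R$ is $s$ times differentiable and $|g^{(s)}(t)-g^{(s)}(t_0)|\le c_0|t-t_0|^v$ for all $t,t_0\in[0,1]$. For $M>0$ let $Lip^{(\diamond,r,c_0)}_M$ be the set of those $f\in Lip^{(\diamond,r,c_0)}$ with $|f|\le M$ on $\mathbb B^d$. *Nets.*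 For $n\ge 2$ put $N_0=d$, $N_1=6$, $N_2=s+3$, $N_3=3n+3$, and let $$\mathcal A_3=2\sum_{k=0}^{3}\prod_{\ell=0}^{3-k}N_{3-\ell}+\prod_{\ell=0}^{3}N_\ell .$$ A net of layer $0$ is a function $x\mapsto\sum_{j=1}^{d}a_j\phi(w_jx^{(j)}+b_j)$. For $k=1,2,3$, a net of layer $k$ is a function $x\mapsto\sum_{j=1}^{N_k}a_j\phi(H_j(x)+b_j)$, where $H_1,\dots,H_{N_k}$ are nets of layer $k-1$, each with its own parameters (tree structure). Let $\mathcal H_n$ be the set of nets of layer $3$ all of whose parameters $a,b,w$, in all layers, are at most $\mathcal R\,\mathcal A_3^{\alpha}$ in absolute value. For sets $U,V$ of functions on $\mathbb B^d$ put $\operatorname{dist}(U,V)=\sup_{f\in U}\inf_{h\in V}\|f-h\|_{L_\infty(\mathbb B^d)}\in[0,\infty]$. Then there is a constant $C_2>0$, independent of $n$, such that for all $n\ge 2$ $$9^{-r}C_2\,(n\log n)^{-r}\le\operatorname{dist}\bigl(Lip^{(\diamond,r,c_0)},\mathcal H_n\bigr).$$ Moreover, for every $M>0$ there are constants $C_2,C_3>0$,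 independent of $n$, such that for all $n\ge 2$ $$9^{-r}C_2\,(n\log n)^{-r}\le\operatorname{dist}\bigl(Lip^{(\diamond,r,c_0)}_M,\mathcal H_n\bigr)\le C_3\,n^{-r}.$$ -/

import Mathlib

open MeasureTheory
open scoped ENNReal ContDiff

/-- The number of free parameters of a tree net with layers `0, …, L` and widths `N 0 = d`,
`N 1, …, N L`:
`A_L = 2 ∑_{k=0}^{L} ∏_{ℓ=0}^{L-k} N_{L-ℓ} + ∏_{ℓ=0}^{L} N_ℓ`. -/
def treeParamCount (N : ℕ → ℕ) (L : ℕ) : ℕ :=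
  2 * ∑ k ∈ Finset.range (L + 1), ∏ l ∈ Finset.range (L - k + 1), N (L - l)
    + ∏ l ∈ Finset.range (L + 1), N l

/-- The functions on `ℝ^d` that are computed by the nodes of layer `k` of a deep net with tree
structure, widths `N 1, N 2, …`, activation function `φ k` in layer `k`, and all parameters
bounded in absolute value by `B`.
Layer `0`: `x ↦ ∑_{j=1}^{d} a_j φ_0 (w_j x^{(j)} + b_j)`.
Layer `k`: `x ↦ ∑_{j=1}^{N_k} a_j φ_k (H_j x + b_j)`, where `H_1, …, H_{N_k}` are nodes of
layer `k-1`. Since the net is a tree, every `H_j` carries parameters of its own, which are chosen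
independently of the others. The outputs of the nets with `L` layers are the elements of
`treeNets d N φ B L`. -/
def treeNets (d : ℕ) (N : ℕ → ℕ) (φ : ℕ → ℝ → ℝ) (B : ℝ) :
    ℕ → Set (EuclideanSpace ℝ (Fin d) → ℝ)
  | 0 => {h | ∃ a w b : Fin d → ℝ,
      (∀ j, |a j| ≤ B ∧ |w j| ≤ B ∧ |b j| ≤ B) ∧
      h = fun x => ∑ j, a j * φ 0 (w j * x j + b j)}
  | k + 1 => {h | ∃ (a b : Fin (N (k + 1)) → ℝ)
        (H : Fin (N (k + 1)) → EuclideanSpace ℝ (Fin d) → ℝ),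
      (∀ j, |a j| ≤ B ∧ |b j| ≤ B) ∧ (∀ j, H j ∈ treeNets d N φ B k) ∧
      h = fun x => ∑ j, a j * φ (k + 1) (H j x + b j)}

/-- The class `H^{tree}_{L,α,R}` of tree nets with `L` layers, widths `N 0 = d`, `N 1, …, N L`, and
all parameters bounded by `R * (A_L)^α`. -/
def boundedTreeNets (d : ℕ) (N : ℕ → ℕ) (φ : ℕ → ℝ → ℝ) (L : ℕ) (α R : ℝ) :
    Set (EuclideanSpace ℝ (Fin d) → ℝ) :=
  treeNets d N φ (R * (treeParamCount N L : ℝ) ^ α) L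

/-- The widths `N_0 = d`, `N_1 = 6`, `N_2 = s + 3`, `N_3 = 3 n + 3` (later values are not used). -/
def radialWidths (d s n : ℕ) : ℕ → ℕ
  | 0 => d
  | 1 => 6
  | 2 => s + 3
  | 3 => 3 * n + 3
  | _ => 0

/-- The class `Lip^{(r,c₀)}` on `[0,1]`, `r = s + v`: the `s` times differentiable functions whose
`s`-th derivative satisfies `|g^{(s)}(t) - g^{(s)}(t₀)| ≤ c₀ |t - t₀|^v` on `[0,1]` (one-sided
derivatives at the endpoints). By this inequality the `s`-th derivative is continuous, so that
`s`-fold differentiability is the same as `ContDiffOn ℝ s`. -/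
def lipUnit (s : ℕ) (v c₀ : ℝ) : Set (ℝ → ℝ) :=
  {g | ContDiffOn ℝ s g (Set.Icc 0 1) ∧
    ∀ t ∈ Set.Icc (0 : ℝ) 1, ∀ t₀ ∈ Set.Icc (0 : ℝ) 1,
      |iteratedDerivWithin s g (Set.Icc 0 1) t - iteratedDerivWithin s g (Set.Icc 0 1) t₀|
        ≤ c₀ * |t - t₀| ^ v}

/-- The class `Lip^{(⋄,r,c₀)}`, `r = s + v`, of radial functions `f x = g (|x|^2)` on the unit ball
of `ℝ^d` with `g` in `Lip^{(r,c₀)}` on `[0,1]`. Only the values on the ball matter. -/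
def radialLip (d s : ℕ) (v c₀ : ℝ) : Set (EuclideanSpace ℝ (Fin d) → ℝ) :=
  {f | ∃ g ∈ lipUnit s v c₀, ∀ x ∈ Metric.closedBall (0 : EuclideanSpace ℝ (Fin d)) 1,
    f x = g (‖x‖ ^ 2)}

/-- The functions of `Lip^{(⋄,r,c₀)}` that are bounded by `M` on the unit ball. -/
def radialLipBdd (d s : ℕ) (v c₀ M : ℝ) : Set (EuclideanSpace ℝ (Fin d) → ℝ) :=
  {f ∈ radialLip d s v c₀ |
    ∀ x ∈ Metric.closedBall (0 : EuclideanSpace ℝ (Fin d)) 1, |f x| ≤ M}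

/-- The deviation `dist(U, V, L_p(𝔹^d)) = sup_{f ∈ U} inf_{g ∈ V} ‖f - g‖_{L_p(𝔹^d)}`, with values
in `[0,∞]`. -/
noncomputable def deviation {d : ℕ} (U V : Set (EuclideanSpace ℝ (Fin d) → ℝ)) (p : ℝ≥0∞) :
    ℝ≥0∞ :=
  ⨆ f ∈ U, ⨅ g ∈ V, eLpNorm (fun x => f x - g x) p
    (volume.restrict (Metric.closedBall (0 : EuclideanSpace ℝ (Fin d)) 1))

/-- The assumption on the activation function: `φ` is infinitely differentiable, `φ` and `φ'` are
bounded by `1`, all derivatives of `φ` (also of order `0`) are nonzero at one common point `θ₀`,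
and `φ(-t) = O(1/t)`, `1 - φ(t) = O(1/t)` as `t → ∞`. -/
structure IsSmoothSigmoidal (φ : ℝ → ℝ) : Prop where
  smooth : ContDiff ℝ ∞ φ
  bounded : ∀ t, |φ t| ≤ 1
  deriv_bounded : ∀ t, |deriv φ t| ≤ 1
  nonvanishing : ∃ θ₀ : ℝ, ∀ j : ℕ, iteratedDeriv j φ θ₀ ≠ 0
  left_tail : (fun t : ℝ => φ (-t)) =O[Filter.atTop] fun t : ℝ => t⁻¹
  right_tail : (fun t : ℝ => 1 - φ t) =O[Filter.atTop] fun t : ℝ => t⁻¹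

/-! The lower bound is a counting argument. A net in the class has `O(n)` parameters, all bounded by
a power of `n` up to a constant. Rounding them to a fine grid splits the class into at most `G ^ (c
n)` cells of small sup-diameter, with `log G = O(log n)` (`coveredBy_radialNets`). On the target
side, `m` disjoint bumps of width `1/m` and height `A m^(-r)` in the variable `|x|²`, each switched
on or off, give `2 ^ m` admissible functions that differ pairwise by `A m^(-r)` somewhere
(`exists_bump_family`). For `m` a large multiple of `n log n` there are more functions than cells
(`cover_count_lt`). If all were approximated well, two would have approximants in one cell and would
be too close to each other (`ofReal_le_deviation_of_coveredBy`). Hence the error is at least of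
order `m^(-r)`.

The upper bound is an explicit net. At a point where no derivative of `φ` vanishes, finite
differences of `φ` reproduce monomials, the identity and products. Layers 0 and 1 compute multiples
of `|x|²` approximately (`exists_norm_sq_net`). Layer 2 computes polynomials of degree at most `s`
in that value, and steepened copies of `φ` that imitate step functions (`exists_poly_node_approx`).
Layer 3 multiplies the two and adds up. The target profile `g` is written as its Taylor polynomial
at `0` plus jumps from each Taylor polynomial to the next, every jump switched on by a step at
`(j+1)/n` (`telescoping_approx`). Everything runs at the single scale `ρ = n^(-(r+1))`: `n` jumps
with error `O(ρ)` each cost `O(n^(-r))`, while the weights stay below a fixed power of `1/ρ`, which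
the parameter bound allows (`exists_splineNet_approx`, `splineNet_mem_treeNets`). -/

/-! ### Covering the classes of nets. -/

/-- `S` is a union of at most `K` sets of functions that differ by at most `ε` on `D`. -/
def CoveredBy {E : Type*} (S : Set (E → ℝ)) (D : Set E) (K : ℕ) (ε : ℝ) : Prop :=
  ∃ (ι : Type) (_ : Fintype ι) (C : ι → Set (E → ℝ)), Fintype.card ι ≤ K ∧
    (∀ f ∈ S, ∃ i, f ∈ C i) ∧ ∀ i, ∀ f ∈ C i, ∀ g ∈ C i, ∀ x ∈ D, |f x - g x| ≤ ε

lemma exists_cell_map (B η : ℝ) (hη : 0 < η) :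
    ∃ c : ℝ → Fin (⌊2 * B / η⌋₊ + 1), ∀ a a', |a| ≤ B → |a'| ≤ B → c a = c a' →
      |a - a'| ≤ η := by
  -- The minimum acts only outside `[-B, B]`, where it keeps the index in range.
  refine ⟨fun a => ⟨min ⌊(a + B) / η⌋₊ ⌊2 * B / η⌋₊, by omega⟩, fun a a' ha ha' h => ?_⟩
  have key : ∀ b : ℝ, |b| ≤ B → min ⌊(b + B) / η⌋₊ ⌊2 * B / η⌋₊ = ⌊(b + B) / η⌋₊ := by
    intro b hb
    have := abs_le.1 hb
    exact min_eq_left (Nat.floor_le_floor (by gcongr; linarith))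
  have h1 : ⌊(a + B) / η⌋₊ = ⌊(a' + B) / η⌋₊ := by
    have := congrArg Fin.val h
    simpa only [key a ha, key a' ha'] using this
  have ha1 := abs_le.1 ha
  have ha2 := abs_le.1 ha'
  have p1 : 0 ≤ (a + B) / η := div_nonneg (by linarith) hη.le
  have p2 : 0 ≤ (a' + B) / η := div_nonneg (by linarith) hη.le
  have l1 := Nat.floor_le p1
  have l2 := Nat.floor_le p2
  have u1 := Nat.lt_floor_add_one ((a + B) / η)
  have u2 := Nat.lt_floor_add_one ((a' + B) / η)
  rw [h1] at l1 u1
  have e : a - a' = ((a + B) / η - (a' + B) / η) * η := by field_simp; ring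
  rw [e, abs_mul, abs_of_pos hη]
  have : |(a + B) / η - (a' + B) / η| ≤ 1 := by rw [abs_le]; constructor <;> linarith
  nlinarith

lemma IsSmoothSigmoidal.abs_sub_le {φ : ℝ → ℝ} (hφ : IsSmoothSigmoidal φ) (x y : ℝ) :
    |φ x - φ y| ≤ |x - y| := by
  have h := Convex.norm_image_sub_le_of_norm_deriv_le (f := φ) (C := 1) (s := Set.univ)
    (fun z _ => (hφ.smooth.differentiable (by simp)).differentiableAt)
    (fun z _ => hφ.deriv_bounded z) convex_univ (Set.mem_univ y) (Set.mem_univ x)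
  simpa using h

lemma abs_mul_sub_mul_le {a a' p p' B η ε : ℝ} (ha : |a - a'| ≤ η) (ha' : |a'| ≤ B)
    (hp : |p| ≤ 1) (hpp : |p - p'| ≤ ε) : |a * p - a' * p'| ≤ η + B * ε := by
  have e : a * p - a' * p' = (a - a') * p + a' * (p - p') := by ring
  rw [e]
  refine (abs_add_le _ _).trans ?_
  rw [abs_mul, abs_mul]
  have h1 : |a - a'| * |p| ≤ η * 1 :=
    mul_le_mul ha hp (abs_nonneg _) ((abs_nonneg _).trans ha)
  have h2 : |a'| * |p - p'| ≤ B * ε :=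
    mul_le_mul ha' hpp (abs_nonneg _) ((abs_nonneg _).trans ha')
  linarith

lemma abs_sum_sub_sum_le {N : ℕ} {f g : Fin N → ℝ} {ε : ℝ} (h : ∀ j, |f j - g j| ≤ ε) :
    |∑ j, f j - ∑ j, g j| ≤ N * ε := by
  rw [← Finset.sum_sub_distrib]
  refine (Finset.abs_sum_le_sum_abs _ _).trans ((Finset.sum_le_sum fun j _ => h j).trans ?_)
  simp

lemma coveredBy_treeNets_zero {φ : ℝ → ℝ} (hφ : IsSmoothSigmoidal φ) (d : ℕ) (N : ℕ → ℕ)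
    (B η : ℝ) (hη : 0 < η) :
    CoveredBy (treeNets d N (fun _ => φ) B 0)
      (Metric.closedBall (0 : EuclideanSpace ℝ (Fin d)) 1)
      ((⌊2 * B / η⌋₊ + 1) ^ (3 * d)) (d * (η + B * (η + η))) := by
  obtain ⟨c, hc⟩ := exists_cell_map B η hη
  refine ⟨Fin d → Fin (⌊2 * B / η⌋₊ + 1) × Fin (⌊2 * B / η⌋₊ + 1) × Fin (⌊2 * B / η⌋₊ + 1),
    inferInstance, fun p => {h | ∃ a w b : Fin d → ℝ,
      (∀ j, |a j| ≤ B ∧ |w j| ≤ B ∧ |b j| ≤ B) ∧ (∀ j, p j = (c (a j), c (w j), c (b j))) ∧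
      h = fun x => ∑ j, a j * φ (w j * x j + b j)}, ?_, ?_, ?_⟩
  · simp only [Fintype.card_fun, Fintype.card_prod, Fintype.card_fin]
    rw [pow_mul]
    exact le_of_eq (by ring)
  · rintro f ⟨a, w, b, hb, rfl⟩
    exact ⟨fun j => (c (a j), c (w j), c (b j)), a, w, b, hb, fun _ => rfl, rfl⟩
  · rintro p f ⟨a, w, b, hB, hp, rfl⟩ g ⟨a', w', b', hB', hp', rfl⟩ x hx
    refine abs_sum_sub_sum_le fun j => ?_
    have e := (hp j).symm.trans (hp' j)
    simp only [Prod.mk.injEq] at e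
    have hxj : |x j| ≤ 1 := by
      have := PiLp.norm_apply_le x j
      simp only [Metric.mem_closedBall, dist_zero_right] at hx
      exact this.trans hx
    refine abs_mul_sub_mul_le (hc _ _ (hB j).1 (hB' j).1 e.1) (hB' j).1 (hφ.bounded _) ?_
    refine (hφ.abs_sub_le _ _).trans ?_
    have e2 : w j * x j + b j - (w' j * x j + b' j) = (w j - w' j) * x j + (b j - b' j) := by ring
    rw [e2]
    refine (abs_add_le _ _).trans (add_le_add ?_ (hc _ _ (hB j).2.2 (hB' j).2.2 e.2.2))
    rw [abs_mul]
    have := hc _ _ (hB j).2.1 (hB' j).2.1 e.2.1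
    nlinarith [abs_nonneg (x j), abs_nonneg (w j - w' j)]

/-- The subnets of a tree have independent parameters, so cells of the new layer are tuples: a grid
cell for each pair `(a j, b j)` and an old cell for each `H j`. As `φ` is bounded by `1` and
1-Lipschitz, an error `ε` below grows at most by the factor `B` in each summand. -/
lemma coveredBy_treeNets_succ {φ : ℝ → ℝ} (hφ : IsSmoothSigmoidal φ) (d : ℕ) (N : ℕ → ℕ)
    (B η : ℝ) (hη : 0 < η) (k K : ℕ) (ε : ℝ) (D : Set (EuclideanSpace ℝ (Fin d)))
    (h : CoveredBy (treeNets d N (fun _ => φ) B k) D K ε) :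
    CoveredBy (treeNets d N (fun _ => φ) B (k + 1)) D
      (((⌊2 * B / η⌋₊ + 1) ^ 2 * K) ^ N (k + 1)) (N (k + 1) * (η + B * (ε + η))) := by
  obtain ⟨c, hc⟩ := exists_cell_map B η hη
  obtain ⟨ι, _, C, hK, hcov, hC⟩ := h
  refine ⟨Fin (N (k + 1)) → (Fin (⌊2 * B / η⌋₊ + 1) × Fin (⌊2 * B / η⌋₊ + 1)) × ι,
    inferInstance, fun p => {h | ∃ (a b : Fin (N (k + 1)) → ℝ)
        (H : Fin (N (k + 1)) → EuclideanSpace ℝ (Fin d) → ℝ),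
      (∀ j, |a j| ≤ B ∧ |b j| ≤ B) ∧ (∀ j, (p j).1 = (c (a j), c (b j)) ∧ H j ∈ C (p j).2) ∧
      h = fun x => ∑ j, a j * φ (H j x + b j)}, ?_, ?_, ?_⟩
  · simp only [Fintype.card_fun, Fintype.card_prod, Fintype.card_fin]
    rw [← pow_two]
    exact Nat.pow_le_pow_left (Nat.mul_le_mul_left _ hK) _
  · rintro f ⟨a, b, H, hB, hH, rfl⟩
    choose i hi using fun j => hcov (H j) (hH j)
    exact ⟨fun j => ((c (a j), c (b j)), i j), a, b, H, hB, fun j => ⟨rfl, hi j⟩, rfl⟩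
  · rintro p f ⟨a, b, H, hB, hp, rfl⟩ g ⟨a', b', H', hB', hp', rfl⟩ x hx
    refine abs_sum_sub_sum_le fun j => ?_
    have e := (hp j).1.symm.trans (hp' j).1
    simp only [Prod.mk.injEq] at e
    refine abs_mul_sub_mul_le (hc _ _ (hB j).1 (hB' j).1 e.1) (hB' j).1 (hφ.bounded _) ?_
    refine (hφ.abs_sub_le _ _).trans ?_
    have e2 : H j x + b j - (H' j x + b' j) = (H j x - H' j x) + (b j - b' j) := by ring
    rw [e2]
    exact (abs_add_le _ _).trans (add_le_add (hC _ _ (hp j).2 _ (hp' j).2 x hx)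
      (hc _ _ (hB j).2 (hB' j).2 e.2))

/-- Only the top width depends on `n`, so both the exponent of the count and the diameter factor are
linear in `n`. Each of the four layers contributes one factor `B`. -/
lemma coveredBy_radialNets {φ : ℝ → ℝ} (hφ : IsSmoothSigmoidal φ) (d s : ℕ) :
    ∃ c : ℕ, 0 < c ∧ ∀ (n : ℕ) (B η : ℝ), 1 ≤ n → 1 ≤ B → 0 < η →
      CoveredBy (treeNets d (radialWidths d s n) (fun _ => φ) B 3)
        (Metric.closedBall (0 : EuclideanSpace ℝ (Fin d)) 1)
        ((⌊2 * B / η⌋₊ + 1) ^ (c * n)) (c * n * B ^ 4 * η) := by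
  -- `P` counts the parameters in one branch at the root, and `Q * n` bounds the product of widths
  -- in the diameter; the factors `6` come from `3 n + 3 ≤ 6 n`.
  set P := 2 + (2 + (2 + 3 * d) * 6) * (s + 3)
  set Q : ℕ := 6 * ((s + 3) * (6 * (3 * d + 2) + 2) + 2)
  refine ⟨6 * P + Q, by positivity, fun n B η hn hB hη => ?_⟩
  have h0 := coveredBy_treeNets_zero hφ d (radialWidths d s n) B η hη
  have h3 := coveredBy_treeNets_succ hφ d _ B η hη 2 _ _ _
    (coveredBy_treeNets_succ hφ d _ B η hη 1 _ _ _
      (coveredBy_treeNets_succ hφ d _ B η hη 0 _ _ _ h0))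
  obtain ⟨ι, i1, C, hK, hcov, hC⟩ := h3
  refine ⟨ι, i1, C, hK.trans ?_, hcov, fun i f hf g hg x hx => (hC i f hf g hg x hx).trans ?_⟩
  · simp only [radialWidths]
    set G := ⌊2 * B / η⌋₊ + 1
    have : (G ^ 2 * (G ^ 2 * (G ^ 2 * G ^ (3 * d)) ^ 6) ^ (s + 3)) ^ (3 * n + 3)
        = G ^ (P * (3 * n + 3)) := by
      simp only [P, ← pow_mul, ← pow_add]
    rw [this]
    refine Nat.pow_le_pow_right (by omega) ?_
    nlinarith [Nat.zero_le P, Nat.zero_le Q, Nat.mul_le_mul_left P hn, Nat.zero_le (Q * n)]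
  · simp only [radialWidths]
    push_cast
    have hn' : (1 : ℝ) ≤ n := by exact_mod_cast hn
    have step : ∀ (N E k : ℕ) (ε : ℝ), ε ≤ E * B ^ (k + 1) * η →
        N * (η + B * (ε + η)) ≤ (N * (E + 2) : ℕ) * B ^ (k + 2) * η := by
      intro N E k ε h
      have b1 : B ≤ B ^ (k + 2) := le_self_pow₀ hB (by omega)
      have : η + B * (ε + η) ≤ (E + 2) * B ^ (k + 2) * η := by
        have h1 : B * ε ≤ B * (E * B ^ (k + 1) * η) := by gcongr
        have h2 : B * (E * B ^ (k + 1) * η) = E * B ^ (k + 2) * η := by ring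
        have h3 : 1 * η ≤ B ^ (k + 2) * η := by gcongr; linarith
        have h4 : B * η ≤ B ^ (k + 2) * η := by gcongr
        nlinarith
      push_cast
      calc (N : ℝ) * (η + B * (ε + η)) ≤ N * ((E + 2) * B ^ (k + 2) * η) := by gcongr
        _ = _ := by ring
    have e0 : (d : ℝ) * (η + B * (η + η)) ≤ (3 * d : ℕ) * B ^ (0 + 1) * η := by
      push_cast
      have : η + B * (η + η) ≤ 3 * B * η := by nlinarith
      calc (d : ℝ) * (η + B * (η + η)) ≤ d * (3 * B * η) := by gcongr
        _ = _ := by ring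
    have e1 := step 6 _ 0 _ e0
    have e2 := step (s + 3) _ 1 _ e1
    have e3 := step (3 * n + 3) _ 2 _ e2
    push_cast at e3
    refine e3.trans ?_
    have : (3 * (n : ℝ) + 3) * ((s + 3) * (6 * (3 * d + 2) + 2) + 2) ≤ (6 * P + Q) * n := by
      have hQ : (Q : ℝ) = 6 * ((s + 3) * (6 * (3 * d + 2) + 2) + 2) := by
        simp only [Q]; push_cast; ring
      rw [hQ]
      have hP : (0 : ℝ) ≤ P := by positivity
      have : (0 : ℝ) ≤ (s + 3) * (6 * (3 * d + 2) + 2) + 2 := by positivity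
      nlinarith [mul_nonneg hP (by linarith : (0 : ℝ) ≤ n)]
    gcongr

/-! ### Many well separated target functions. -/

lemma exists_smooth_bump : ∃ ψ : ℝ → ℝ, ContDiff ℝ ∞ ψ ∧ ψ (1 / 2) = 1 ∧
    (∀ k y, y ∉ Set.Ioo (0 : ℝ) 1 → iteratedDeriv k ψ y = 0) ∧
    ∀ k, ∃ L : ℝ, 0 ≤ L ∧ ∀ y, |iteratedDeriv k ψ y| ≤ L := by
  let b : ContDiffBump (1 / 2 : ℝ) := ⟨1 / 4, 1 / 3, by norm_num, by norm_num⟩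
  have hsm : ContDiff ℝ ∞ (b : ℝ → ℝ) := b.contDiff
  have hsupp : ∀ k y, y ∉ Set.Ioo (0 : ℝ) 1 → iteratedDeriv k (b : ℝ → ℝ) y = 0 := by
    intro k y hy
    by_contra hne
    have h1 : y ∈ Function.support (iteratedFDeriv ℝ k (b : ℝ → ℝ)) := by
      intro h0
      apply hne
      rw [iteratedDeriv, h0]
      rfl
    have h2 := support_iteratedFDeriv_subset k h1
    rw [b.tsupport_eq, Metric.mem_closedBall, Real.dist_eq] at h2
    have h3 : |y - 1 / 2| ≤ 1 / 3 := h2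
    rw [abs_le] at h3
    exact hy ⟨by linarith, by linarith⟩
  refine ⟨b, hsm, b.one_of_mem_closedBall (by simp [b]), hsupp, fun k => ?_⟩
  have hc : Continuous (iteratedDeriv k (b : ℝ → ℝ)) :=
    hsm.continuous_iteratedDeriv k (by exact_mod_cast le_top)
  obtain ⟨L, hL⟩ := (isCompact_Icc (a := (0 : ℝ)) (b := 1)).exists_bound_of_continuousOn
    hc.continuousOn
  refine ⟨max L 0, le_max_right _ _, fun y => ?_⟩
  by_cases hy : y ∈ Set.Icc (0 : ℝ) 1
  · exact (hL y hy).trans (le_max_left _ _)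
  · rw [hsupp k y (fun h => hy (Set.Ioo_subset_Icc_self h))]
    simp

/-- Integer translates of `(0, 1)` are disjoint, so at most one summand is nonzero. -/
lemma abs_sum_translates_le {m : ℕ} {w : Fin m → ℝ} (hw : ∀ j, |w j| ≤ 1) {Ψ : ℝ → ℝ} {L : ℝ}
    (hL : 0 ≤ L) (hb : ∀ y, |Ψ y| ≤ L) (h0 : ∀ y, y ∉ Set.Ioo (0 : ℝ) 1 → Ψ y = 0) (y : ℝ) :
    |∑ j, w j * Ψ (y - (j : ℕ))| ≤ L := by
  by_cases h : ∃ j : Fin m, y - (j : ℕ) ∈ Set.Ioo (0 : ℝ) 1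
  · obtain ⟨j, hj⟩ := h
    rw [Finset.sum_eq_single j]
    · rw [abs_mul]
      nlinarith [hw j, hb (y - (j : ℕ)), abs_nonneg (w j), abs_nonneg (Ψ (y - (j : ℕ)))]
    · intro i _ hij
      rw [h0, mul_zero]
      intro hi
      apply hij
      have a1 : ((i : ℕ) : ℝ) < (j : ℕ) + 1 := by linarith [hi.2, hj.2, hi.1, hj.1]
      have a2 : ((j : ℕ) : ℝ) < (i : ℕ) + 1 := by linarith [hi.2, hj.2, hi.1, hj.1]
      have a1' : (i : ℕ) < (j : ℕ) + 1 := by exact_mod_cast a1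
      have a2' : (j : ℕ) < (i : ℕ) + 1 := by exact_mod_cast a2
      exact Fin.ext (by omega)
    · simp
  · push Not at h
    rw [Finset.sum_eq_zero fun j _ => by rw [h0 _ (h j), mul_zero]]
    simpa using hL

/-- Interpolates a Lipschitz bound (used for `x ≤ 1`) and a uniform bound (used for `x ≥ 1`) to a
Hölder bound. -/
lemma min_le_mul_rpow {L L' x v D : ℝ} (hL : 0 ≤ L) (hL' : 0 ≤ L') (hx : 0 ≤ x) (hv₀ : 0 < v)
    (hv₁ : v ≤ 1) (h1 : D ≤ L' * x) (h2 : D ≤ L) : D ≤ (L' + L) * x ^ v := by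
  rcases le_total x 1 with h | h
  · have : x ≤ x ^ v := Real.self_le_rpow_of_le_one hx h hv₁
    have h0 : 0 ≤ x ^ v := Real.rpow_nonneg hx v
    nlinarith [mul_le_mul_of_nonneg_left this hL', mul_nonneg hL h0]
  · have : 1 ≤ x ^ v := Real.one_le_rpow h hv₀.le
    nlinarith [mul_le_mul_of_nonneg_left this hL, mul_nonneg hL' (by linarith : 0 ≤ x ^ v)]

/-- The family is `A m^(-r) ∑ w_j ψ(m t - j)`. Differentiating `s` times gains `m^s` and the Hölder
quotient gains `m^v`; together they cancel `m^(-r)`, so a small `A` works for every `m`. -/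
lemma exists_bump_family (s : ℕ) (v r c₀ M : ℝ) (hv₀ : 0 < v) (hv₁ : v ≤ 1) (hr : r = s + v)
    (hc₀ : 0 < c₀) (hM : 0 < M) :
    ∃ A : ℝ, 0 < A ∧ ∀ m : ℕ, 1 ≤ m → ∃ g : (Fin m → ℝ) → ℝ → ℝ,
      ∀ w : Fin m → ℝ, (∀ j, |w j| ≤ 1) → g w ∈ lipUnit s v c₀ ∧ Continuous (g w) ∧
        (∀ t, |g w t| ≤ M) ∧
        ∀ j : Fin m, g w (((j : ℕ) + 1 / 2) / m) = A * (m : ℝ) ^ (-r) * w j := by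
  obtain ⟨ψ, hψ, hψ1, hψ0, hψb⟩ := exists_smooth_bump
  obtain ⟨L0, hL0, hb0⟩ := hψb 0
  obtain ⟨L, hL, hb⟩ := hψb s
  obtain ⟨L', hL', hb'⟩ := hψb (s + 1)
  obtain ⟨A, hA, hA1, hA2⟩ : ∃ A : ℝ, 0 < A ∧ A * (L' + 2 * L) ≤ c₀ ∧ A * L0 ≤ M := by
    refine ⟨min (c₀ / (L' + 2 * L + 1)) (M / (L0 + 1)), by positivity, ?_, ?_⟩
    · calc _ ≤ c₀ / (L' + 2 * L + 1) * (L' + 2 * L + 1) := by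
            refine mul_le_mul (min_le_left _ _) (by linarith) (by positivity) (by positivity)
        _ = c₀ := by field_simp
    · calc _ ≤ M / (L0 + 1) * (L0 + 1) := by
            refine mul_le_mul (min_le_right _ _) (by linarith) hL0 (by positivity)
        _ = M := by field_simp
  refine ⟨A, hA, fun m hm => ?_⟩
  have hm0 : (0 : ℝ) < m := by exact_mod_cast hm
  have hm1 : (1 : ℝ) ≤ m := by exact_mod_cast hm
  have hr0 : 0 ≤ r := by rw [hr]; positivity
  set a := A * (m : ℝ) ^ (-r) with ha
  have ha0 : 0 < a := by positivity
  have haA : a ≤ A := by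
    have : (m : ℝ) ^ (-r) ≤ 1 := Real.rpow_le_one_of_one_le_of_nonpos hm1 (by linarith)
    nlinarith
  have has : a * (m : ℝ) ^ s * (m : ℝ) ^ v = A := by
    rw [ha, mul_assoc, mul_assoc, ← Real.rpow_natCast, ← Real.rpow_add hm0, ← Real.rpow_add hm0,
      hr]
    simp
  let F : (Fin m → ℝ) → ℝ → ℝ := fun w y => ∑ j, w j * ψ (y - (j : ℕ))
  have hF : ∀ w, ContDiff ℝ ∞ (F w) := fun w =>
    ContDiff.sum fun j _ => contDiff_const.mul (hψ.comp (contDiff_id.sub contDiff_const))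
  have hFd : ∀ w k y, iteratedDeriv k (F w) y = ∑ j, w j * iteratedDeriv k ψ (y - (j : ℕ)) := by
    intro w k y
    have hk : ((k : ℕ∞) : WithTop ℕ∞) ≤ ((⊤ : ℕ∞) : WithTop ℕ∞) := by exact_mod_cast le_top
    rw [iteratedDeriv_fun_sum]
    · refine Finset.sum_congr rfl fun j _ => ?_
      rw [iteratedDeriv_const_mul_field, iteratedDeriv_comp_sub_const]
    · intro j _
      exact (contDiff_const.mul ((hψ.of_le hk).comp (contDiff_id.sub contDiff_const))).contDiffAt
  have hg : ∀ w, ContDiff ℝ ∞ (fun t => a * F w (m * t)) := fun w =>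
    contDiff_const.mul ((hF w).comp (contDiff_const.mul contDiff_id))
  have hs' : (s : WithTop ℕ∞) ≤ ((⊤ : ℕ∞) : WithTop ℕ∞) := by exact_mod_cast le_top
  refine ⟨fun w t => a * F w (m * t), fun w hw => ⟨⟨((hg w).of_le hs').contDiffOn, ?_⟩,
    (hg w).continuous, ?_, ?_⟩⟩
  · intro t ht t₀ ht₀
    have hd : ∀ u ∈ Set.Icc (0 : ℝ) 1, iteratedDerivWithin s (fun t => a * F w (m * t))
        (Set.Icc 0 1) u = a * (m ^ s * iteratedDeriv s (F w) (m * u)) := by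
      intro u hu
      rw [iteratedDerivWithin_eq_iteratedDeriv (uniqueDiffOn_Icc zero_lt_one)
        ((hg w).of_le hs').contDiffAt hu, iteratedDeriv_const_mul_field,
        iteratedDeriv_comp_const_mul ((hF w).of_le hs')]
    rw [hd t ht, hd t₀ ht₀]
    have key : |iteratedDeriv s (F w) (m * t) - iteratedDeriv s (F w) (m * t₀)|
        ≤ (L' + 2 * L) * |m * t - m * t₀| ^ v := by
      refine min_le_mul_rpow (by positivity) hL' (abs_nonneg _) hv₀ hv₁ ?_ ?_
      · have := Convex.norm_image_sub_le_of_norm_deriv_le (f := iteratedDeriv s (F w)) (C := L')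
          (s := Set.univ) (x := m * t₀) (y := m * t)
          (fun z _ => ((hF w).differentiable_iteratedDeriv s
            (by exact_mod_cast WithTop.coe_lt_top s)).differentiableAt)
          (fun z _ => by
            rw [← iteratedDeriv_succ, hFd]
            exact abs_sum_translates_le hw hL' hb' (hψ0 (s + 1)) z)
          convex_univ trivial trivial
        simpa using this
      · refine (abs_sub _ _).trans ?_
        rw [hFd, hFd]
        have h1 := abs_sum_translates_le hw hL hb (hψ0 s) (m * t)
        have h2 := abs_sum_translates_le hw hL hb (hψ0 s) (m * t₀)
        linarith
    have e : a * (m ^ s * iteratedDeriv s (F w) (m * t))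
        - a * (m ^ s * iteratedDeriv s (F w) (m * t₀))
        = a * m ^ s * (iteratedDeriv s (F w) (m * t) - iteratedDeriv s (F w) (m * t₀)) := by ring
    rw [e, abs_mul, abs_of_pos (by positivity : 0 < a * (m : ℝ) ^ s)]
    rw [← mul_sub, abs_mul, abs_of_pos hm0, Real.mul_rpow hm0.le (abs_nonneg _)] at key
    calc _ ≤ a * m ^ s * ((L' + 2 * L) * (m ^ v * |t - t₀| ^ v)) := by gcongr
      _ = (a * m ^ s * m ^ v) * (L' + 2 * L) * |t - t₀| ^ v := by ring
      _ ≤ c₀ * |t - t₀| ^ v := by rw [has]; gcongr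
  · intro t
    show |a * F w (m * t)| ≤ M
    rw [abs_mul, abs_of_pos ha0]
    have : |F w (m * t)| ≤ L0 :=
      abs_sum_translates_le hw hL0 (by simpa using hb0) (by simpa using hψ0 0) _
    calc a * |F w (m * t)| ≤ A * L0 := by gcongr
      _ ≤ M := hA2
  · intro j
    show a * F w (m * (((j : ℕ) + 1 / 2) / m)) = a * w j
    congr 1
    rw [mul_div_cancel₀ _ hm0.ne']
    show ∑ i, w i * ψ ((j : ℕ) + 1 / 2 - (i : ℕ)) = w j
    rw [Finset.sum_eq_single j]
    · rw [add_sub_cancel_left, hψ1, mul_one]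
    · intro i _ hij
      have := hψ0 0 ((j : ℕ) + 1 / 2 - (i : ℕ))
      rw [iteratedDeriv_zero] at this
      rw [this, mul_zero]
      rintro ⟨h1, h2⟩
      apply hij
      have a1 : ((i : ℕ) : ℝ) < (j : ℕ) + 1 := by linarith
      have a2 : ((j : ℕ) : ℝ) < (i : ℕ) + 1 := by linarith
      have a1' : (i : ℕ) < (j : ℕ) + 1 := by exact_mod_cast a1
      have a2' : (j : ℕ) < (i : ℕ) + 1 := by exact_mod_cast a2
      exact Fin.ext (by omega)
    · simp

/-! ### The lower bound by pigeonhole. -/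

lemma ofReal_le_deviation_of_coveredBy {d m K : ℕ} {ε δ : ℝ} (hδ : 0 ≤ δ)
    {U S : Set (EuclideanSpace ℝ (Fin d) → ℝ)}
    (hS : CoveredBy S (Metric.closedBall (0 : EuclideanSpace ℝ (Fin d)) 1) K ε) (hK : K < 2 ^ m)
    (f : (Fin m → Bool) → EuclideanSpace ℝ (Fin d) → ℝ) (hfU : ∀ σ, f σ ∈ U)
    (hfc : ∀ σ, Continuous (f σ))
    (hsep : ∀ σ σ', σ ≠ σ' → ∃ x ∈ Metric.ball (0 : EuclideanSpace ℝ (Fin d)) 1,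
      ε + 2 * δ < |f σ x - f σ' x|) :
    ENNReal.ofReal δ ≤ deviation U S ∞ := by
  by_contra hlt
  rw [not_le] at hlt
  have h1 : ∀ σ, ∃ h ∈ S, ∀ᵐ x ∂(volume.restrict
      (Metric.closedBall (0 : EuclideanSpace ℝ (Fin d)) 1)), |f σ x - h x| ≤ δ := by
    intro σ
    have h2 : ⨅ g ∈ S, eLpNorm (fun x => f σ x - g x) ∞
        (volume.restrict (Metric.closedBall (0 : EuclideanSpace ℝ (Fin d)) 1))
        < ENNReal.ofReal δ := by
      refine lt_of_le_of_lt ?_ hlt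
      exact le_iSup₂ (f := fun (f : EuclideanSpace ℝ (Fin d) → ℝ) (_ : f ∈ U) =>
        ⨅ g ∈ S, eLpNorm (fun x => f x - g x) ∞
        (volume.restrict (Metric.closedBall (0 : EuclideanSpace ℝ (Fin d)) 1))) (f σ) (hfU σ)
    simp only [iInf_lt_iff] at h2
    obtain ⟨h, hh, h3⟩ := h2
    refine ⟨h, hh, ?_⟩
    rw [eLpNorm_exponent_top] at h3
    filter_upwards [ae_le_eLpNormEssSup (f := fun x => f σ x - h x)
      (μ := volume.restrict (Metric.closedBall (0 : EuclideanSpace ℝ (Fin d)) 1))] with x hx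
    have h4 := hx.trans h3.le
    rw [← ofReal_norm] at h4
    exact (ENNReal.ofReal_le_ofReal_iff hδ).1 h4
  choose h hh hae using h1
  obtain ⟨ι, _, C, hcard, hcov, hC⟩ := hS
  choose i hi using fun σ => hcov (h σ) (hh σ)
  have hcard' : Fintype.card ι < Fintype.card (Fin m → Bool) := by
    simpa using hcard.trans_lt hK
  obtain ⟨σ, σ', hne, heq⟩ := Fintype.exists_ne_map_eq_of_card_lt i hcard'
  obtain ⟨x₀, hx₀, hx₀'⟩ := hsep σ σ' hne
  -- The approximation holds only almost everywhere. Continuity spreads the separation at `x₀` to a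
  -- nonempty open set, which is not null.
  set V := Metric.ball (0 : EuclideanSpace ℝ (Fin d)) 1 ∩
    {x | ε + 2 * δ < |f σ x - f σ' x|} with hV
  have hVo : IsOpen V := Metric.isOpen_ball.inter
    (isOpen_lt continuous_const ((hfc σ).sub (hfc σ')).abs)
  have hVpos : 0 < volume V := hVo.measure_pos volume ⟨x₀, hx₀, hx₀'⟩
  have hae2 := (hae σ).and (hae σ')
  rw [ae_restrict_iff' Metric.isClosed_closedBall.measurableSet] at hae2
  refine hVpos.ne' (measure_mono_null ?_ (ae_iff.1 hae2))
  rintro x ⟨hx1, hx2⟩ hx3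
  have hxB := Metric.ball_subset_closedBall hx1
  obtain ⟨e1, e2⟩ := hx3 hxB
  have e3 := hC (i σ) (h σ) (hi σ) (h σ') (by rw [heq]; exact hi σ') x hxB
  have hx2' : ε + 2 * δ < |f σ x - f σ' x| := hx2
  rw [abs_le] at e1 e2 e3
  refine absurd hx2' (not_lt.2 ?_)
  rw [abs_le]
  constructor <;> linarith

lemma treeParamCount_radialWidths_bounds (d s : ℕ) : ∃ c : ℕ, 0 < c ∧ ∀ n : ℕ, 1 ≤ n →
    n ≤ treeParamCount (radialWidths d s n) 3 ∧
      treeParamCount (radialWidths d s n) 3 ≤ c * n := by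
  have e : ∀ n, treeParamCount (radialWidths d s n) 3 =
      (2 * (1 + (s + 3) + (s + 3) * 6 + (s + 3) * 6 * d) + d * 6 * (s + 3)) * (3 * n + 3) := by
    intro n
    simp [treeParamCount, Finset.sum_range_succ, Finset.prod_range_succ, radialWidths]
    ring
  refine ⟨6 * (2 * (1 + (s + 3) + (s + 3) * 6 + (s + 3) * 6 * d) + d * 6 * (s + 3)),
    by positivity, fun n hn => ?_⟩
  rw [e]
  set Q := 2 * (1 + (s + 3) + (s + 3) * 6 + (s + 3) * 6 * d) + d * 6 * (s + 3) with hQ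
  have : 1 ≤ Q := by
    have : 0 ≤ (s + 3) * 6 * d := by positivity
    have : 0 ≤ d * 6 * (s + 3) := by positivity
    omega
  constructor
  · nlinarith
  · nlinarith

lemma exists_large_dominating_log (a b : ℝ) (hb : 0 ≤ b) :
    ∃ C : ℝ, 1 ≤ C ∧ a + b * Real.log (C + 1) ≤ C / 2 := by
  have h := Real.isLittleO_log_id_atTop.bound (c := 1 / (4 * (b + 1))) (by positivity)
  obtain ⟨y, hy, hy2⟩ := (h.and (Filter.eventually_ge_atTop (max 2 (4 * a + 4)))).exists
  have h2 : 2 ≤ y := (le_max_left _ _).trans hy2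
  have h3 : 4 * a + 4 ≤ y := (le_max_right _ _).trans hy2
  refine ⟨y - 1, by linarith, ?_⟩
  rw [sub_add_cancel]
  have h4 : Real.log y ≤ 1 / (4 * (b + 1)) * y := by
    have := (le_abs_self _).trans hy
    simpa [abs_of_nonneg (by linarith : 0 ≤ y)] using this
  have h5 : b * Real.log y ≤ y / 4 := by
    calc b * Real.log y ≤ b * (1 / (4 * (b + 1)) * y) := by gcongr
      _ = (b / (b + 1)) * (y / 4) := by field_simp
      _ ≤ 1 * (y / 4) := by
        gcongr
        rw [div_le_one (by linarith)]
        linarith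
      _ = y / 4 := one_mul _
  linarith

/-- The logarithm of the count is `c n log G`, and `G` is polynomial in `n` and `m`, so it is `O(n
log n)`. The implied constant contains `log (C + 1)`, since `m` itself grows with `C`; hence `C`
must dominate a multiple of its own logarithm. -/
lemma cover_count_lt (c c' : ℕ) (hc : 0 < c) (hc' : 0 < c') (A r R α : ℝ) (hA : 0 < A)
    (hr : 0 < r) (hR : 1 ≤ R) (hα : 0 ≤ α) :
    ∃ C : ℝ, 1 ≤ C ∧ ∀ (n m T : ℕ), 2 ≤ n → 1 ≤ T → T ≤ c' * n →
      C * (n * Real.log n) ≤ m → (m : ℝ) ≤ (C + 1) * (n * Real.log n) → 1 ≤ m →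
      (⌊2 * (R * (T : ℝ) ^ α) /
        (A * (m : ℝ) ^ (-r) / (4 * (c * n * (R * (T : ℝ) ^ α) ^ 4)))⌋₊ + 1) ^ (c * n)
        < 2 ^ m := by
  set β₁ := Real.log (8 * c / A + 1) + 5 * (Real.log R + α * Real.log c') with hβ₁
  have hcR : (0 : ℝ) < c := by exact_mod_cast hc
  have hc'R : (1 : ℝ) ≤ c' := by exact_mod_cast hc'
  have hβ₁0 : 0 ≤ β₁ := by
    have h1 : 0 ≤ Real.log (8 * c / A + 1) := Real.log_nonneg (by
      have : 0 ≤ 8 * c / A := by positivity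
      linarith)
    have h2 := Real.log_nonneg hR
    have h3 := mul_nonneg hα (Real.log_nonneg hc'R)
    rw [hβ₁]; linarith
  -- The power of `n` in `n * B ^ 5 * m ^ r`, given `B = O(n ^ α)` and `m = O(n ^ 2)`.
  set β₀ := 1 + 5 * α + 2 * r with hβ₀
  obtain ⟨C, hC1, hC⟩ := exists_large_dominating_log (c * (2 * β₁ + β₀)) (c * (2 * r))
    (by positivity)
  refine ⟨C, hC1, fun n m T hn hT hTn hm hm' hm1 => ?_⟩
  have hnR : (2 : ℝ) ≤ n := by exact_mod_cast hn
  have hmR : (1 : ℝ) ≤ m := by exact_mod_cast hm1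
  have hTR : (1 : ℝ) ≤ T := by exact_mod_cast hT
  have hTnR : (T : ℝ) ≤ c' * n := by exact_mod_cast hTn
  have hlog : 1 / 2 < Real.log n := by
    have := Real.log_two_gt_d9
    have := Real.log_le_log (by norm_num) hnR
    linarith
  set B := R * (T : ℝ) ^ α with hB
  have hTα : 1 ≤ (T : ℝ) ^ α := Real.one_le_rpow hTR hα
  have hB1 : 1 ≤ B := by rw [hB]; nlinarith
  have hmr : 1 ≤ (m : ℝ) ^ r := Real.one_le_rpow hmR hr.le
  set G : ℕ := ⌊2 * B / (A * (m : ℝ) ^ (-r) / (4 * (c * n * B ^ 4)))⌋₊ + 1 with hG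
  have hGle : (G : ℝ) ≤ (8 * c / A + 1) * (n * B ^ 5 * (m : ℝ) ^ r) := by
    have h0 : 0 ≤ 2 * B / (A * (m : ℝ) ^ (-r) / (4 * (c * n * B ^ 4))) := by positivity
    have h1 : (G : ℝ) ≤ 2 * B / (A * (m : ℝ) ^ (-r) / (4 * (c * n * B ^ 4))) + 1 := by
      rw [hG]; push_cast
      linarith [Nat.floor_le h0]
    have h2 : 2 * B / (A * (m : ℝ) ^ (-r) / (4 * (c * n * B ^ 4)))
        = 8 * c / A * (n * B ^ 5 * (m : ℝ) ^ r) := by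
      rw [Real.rpow_neg (by linarith)]
      field_simp
      ring
    have h3 : 1 ≤ n * B ^ 5 * (m : ℝ) ^ r := by
      have := one_le_pow₀ hB1 (n := 5)
      exact one_le_mul_of_one_le_of_one_le
        (one_le_mul_of_one_le_of_one_le (by linarith) this) hmr
    rw [h2] at h1
    linarith
  have hlogB : Real.log B ≤ Real.log R + α * (Real.log c' + Real.log n) := by
    rw [hB, Real.log_mul (by positivity) (by positivity), Real.log_rpow (by linarith)]
    have := Real.log_le_log (by linarith) hTnR
    rw [Real.log_mul (by positivity) (by positivity)] at this
    gcongr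
  have hlogm : Real.log m ≤ Real.log (C + 1) + 2 * Real.log n := by
    have h1 : (m : ℝ) ≤ (C + 1) * (n * n) := by
      refine hm'.trans ?_
      gcongr
      exact Real.log_le_self (by linarith)
    have := Real.log_le_log (by linarith) h1
    rw [Real.log_mul (by positivity) (by positivity),
      Real.log_mul (by positivity) (by positivity)] at this
    linarith
  have hG0 : (0 : ℝ) < G := by rw [hG]; positivity
  -- As `log n > 1/2`, a nonnegative constant is at most twice itself times `log n`.
  have hlogG : Real.log G ≤ (2 * β₁ + β₀ + 2 * r * Real.log (C + 1)) * Real.log n := by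
    have h1 := Real.log_le_log hG0 hGle
    have h8 : 0 < 8 * c / A + 1 := by positivity
    rw [Real.log_mul h8.ne' (by positivity), Real.log_mul (by positivity) (by positivity),
      Real.log_mul (by positivity) (by positivity), Real.log_pow,
      Real.log_rpow (by linarith)] at h1
    push_cast at h1
    have h2 : r * Real.log m ≤ r * (Real.log (C + 1) + 2 * Real.log n) := by gcongr
    have h3 : Real.log G ≤ β₁ + r * Real.log (C + 1) + β₀ * Real.log n := by
      rw [hβ₁, hβ₀]
      nlinarith
    have h4 : 0 ≤ β₁ + r * Real.log (C + 1) :=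
      add_nonneg hβ₁0 (mul_nonneg hr.le (Real.log_nonneg (by linarith)))
    nlinarith
  have hfin : ((c * n : ℕ) : ℝ) * Real.log G < m * Real.log 2 := by
    have hl2 : 1 / 2 < Real.log 2 := by linarith [Real.log_two_gt_d9]
    have hnl : 0 < n * Real.log n := by positivity
    calc ((c * n : ℕ) : ℝ) * Real.log G
        ≤ c * n * ((2 * β₁ + β₀ + 2 * r * Real.log (C + 1)) * Real.log n) := by
          push_cast; gcongr
      _ = (c * (2 * β₁ + β₀) + c * (2 * r) * Real.log (C + 1)) * (n * Real.log n) := by ring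
      _ ≤ C / 2 * (n * Real.log n) := by gcongr
      _ = C * (n * Real.log n) * (1 / 2) := by ring
      _ ≤ m * (1 / 2) := by gcongr
      _ < m * Real.log 2 := by gcongr
  have : (G : ℝ) ^ (c * n) < (2 : ℝ) ^ m := by
    rw [← Real.log_lt_log_iff (by positivity) (by positivity), Real.log_pow, Real.log_pow]
    exact hfin
  exact_mod_cast this

lemma exists_norm_sq_eq {d : ℕ} (hd : 0 < d) {t : ℝ} (ht : 0 ≤ t) :
    ∃ x : EuclideanSpace ℝ (Fin d), ‖x‖ ^ 2 = t := by
  refine ⟨EuclideanSpace.single (⟨0, hd⟩ : Fin d) (√t), ?_⟩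
  rw [PiLp.norm_single, Real.norm_eq_abs, sq_abs, Real.sq_sqrt ht]

lemma abs_boole_sub_boole {a b : Bool} (h : a ≠ b) :
    |(if a then (1 : ℝ) else 0) - if b then 1 else 0| = 1 := by
  cases a <;> cases b <;> simp_all

lemma exists_lower_bound (d : ℕ) (hd : 0 < d) (φ : ℝ → ℝ) (hφ : IsSmoothSigmoidal φ)
    (s : ℕ) (v r c₀ : ℝ) (hv₀ : 0 < v) (hv₁ : v ≤ 1) (hr : r = s + v) (hc₀ : 0 < c₀)
    (R : ℝ) (hR : 1 ≤ R) (α : ℝ) (hα : 0 ≤ α) (M : ℝ) (hM : 0 < M) :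
    ∃ C₂ : ℝ, 0 < C₂ ∧ ∀ n : ℕ, 2 ≤ n →
      ENNReal.ofReal ((9 : ℝ) ^ (-r) * C₂ * ((n : ℝ) * Real.log n) ^ (-r))
        ≤ deviation (radialLipBdd d s v c₀ M)
            (boundedTreeNets d (radialWidths d s n) (fun _ => φ) 3 α R) ∞ := by
  have hr0 : 0 < r := by rw [hr]; positivity
  obtain ⟨A, hA, hbump⟩ := exists_bump_family s v r c₀ M hv₀ hv₁ hr hc₀ hM
  obtain ⟨c, hc, hcov⟩ := coveredBy_radialNets hφ d s
  obtain ⟨c', hc', hT⟩ := treeParamCount_radialWidths_bounds d s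
  obtain ⟨C, hC1, hC⟩ := cover_count_lt c c' hc hc' A r R α hA hr0 hR hα
  -- The factor `9 ^ r` only cancels the `9 ^ (-r)` of the statement.
  refine ⟨9 ^ r * (A / 4 * (C + 1) ^ (-r)), by positivity, fun n hn => ?_⟩
  have hnR : (2 : ℝ) ≤ n := by exact_mod_cast hn
  have hlog : 1 / 2 < Real.log n := by
    have := Real.log_two_gt_d9
    have := Real.log_le_log (by norm_num) hnR
    linarith
  have hnl : 1 ≤ n * Real.log n := by nlinarith
  set m := ⌈C * (n * Real.log n)⌉₊ with hm
  have hm1 : C * (n * Real.log n) ≤ m := Nat.le_ceil _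
  have hm2 : (m : ℝ) ≤ (C + 1) * (n * Real.log n) := by
    have := (Nat.ceil_lt_add_one (by positivity : 0 ≤ C * (n * Real.log n))).le
    linarith
  have hmR : (1 : ℝ) ≤ m := by nlinarith
  have hm3 : 1 ≤ m := by exact_mod_cast hmR
  obtain ⟨hT1, hT2⟩ := hT n (by omega)
  set T := treeParamCount (radialWidths d s n) 3 with hTdef
  have hcount := hC n m T hn (by omega) hT2 hm1 hm2 hm3
  have hTR : (1 : ℝ) ≤ T := by exact_mod_cast (by omega : 1 ≤ T)
  have hTα : 1 ≤ (T : ℝ) ^ α := Real.one_le_rpow hTR hα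
  set B := R * (T : ℝ) ^ α with hB
  have hB1 : 1 ≤ B := by rw [hB]; nlinarith
  have hcR : (0 : ℝ) < c := by exact_mod_cast hc
  -- The mesh makes the cell diameter `c n B⁴ η` equal to `a / 4` with `a = A m^(-r)`. With
  -- tolerance `a / 4` as well, two approximants in one cell allow a distance of `3 a / 4`, less
  -- than the separation `a`.
  have hcover := hcov n B (A * (m : ℝ) ^ (-r) / (4 * (c * n * B ^ 4))) (by omega) hB1
    (by positivity)
  obtain ⟨g, hg⟩ := hbump m hm3
  let w : (Fin m → Bool) → Fin m → ℝ := fun σ j => if σ j then 1 else 0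
  have hw : ∀ σ j, |w σ j| ≤ 1 := by
    intro σ j
    by_cases h : σ j <;> simp [w, h]
  have ha : 0 < A * (m : ℝ) ^ (-r) := by positivity
  have main : ENNReal.ofReal (A * (m : ℝ) ^ (-r) / 4) ≤ deviation (radialLipBdd d s v c₀ M)
            (boundedTreeNets d (radialWidths d s n) (fun _ => φ) 3 α R) ∞ := by
    refine ofReal_le_deviation_of_coveredBy (by positivity) hcover hcount
      (fun σ x => g (w σ) (‖x‖ ^ 2)) ?_ ?_ ?_
    · intro σ
      obtain ⟨h1, h2, h3, h4⟩ := hg (w σ) (hw σ)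
      exact ⟨⟨g (w σ), h1, fun x _ => rfl⟩, fun x _ => h3 _⟩
    · intro σ
      exact (hg (w σ) (hw σ)).2.1.comp (continuous_norm.pow 2)
    · intro σ σ' hne
      obtain ⟨j, hj⟩ := Function.ne_iff.1 hne
      have hj1 : ((j : ℕ) : ℝ) + 1 ≤ m := by exact_mod_cast j.2
      obtain ⟨x, hx⟩ := exists_norm_sq_eq hd
        (by positivity : (0 : ℝ) ≤ (((j : ℕ) : ℝ) + 1 / 2) / m)
      refine ⟨x, ?_, ?_⟩
      · rw [Metric.mem_ball, dist_zero_right]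
        have : ‖x‖ ^ 2 < 1 := by
          rw [hx, div_lt_one (by linarith)]
          linarith
        nlinarith [norm_nonneg x]
      · have e1 := (hg (w σ) (hw σ)).2.2.2 j
        have e2 := (hg (w σ') (hw σ')).2.2.2 j
        have e3 : |w σ j - w σ' j| = 1 := by
          exact abs_boole_sub_boole hj
        simp only [hx]
        rw [e1, e2, ← mul_sub, abs_mul, e3, abs_of_pos ha]
        have : c * n * B ^ 4 * (A * (m : ℝ) ^ (-r) / (4 * (c * n * B ^ 4)))
            = A * (m : ℝ) ^ (-r) / 4 := by
          have : (0 : ℝ) < n := by linarith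
          field_simp
        rw [this]
        linarith
  refine le_trans (ENNReal.ofReal_le_ofReal ?_) main
  have h9 : (9 : ℝ) ^ (-r) * 9 ^ r = 1 := by
    rw [← Real.rpow_add (by norm_num)]; simp
  calc (9 : ℝ) ^ (-r) * (9 ^ r * (A / 4 * (C + 1) ^ (-r))) * (n * Real.log n) ^ (-r)
      = (9 : ℝ) ^ (-r) * 9 ^ r * (A / 4) * ((C + 1) ^ (-r) * (n * Real.log n) ^ (-r)) := by ring
    _ = A / 4 * ((C + 1) * (n * Real.log n)) ^ (-r) := by
      rw [h9, Real.mul_rpow (x := C + 1) (by linarith) (by linarith)]; ring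
    _ ≤ A / 4 * (m : ℝ) ^ (-r) := by
      gcongr A / 4 * ?_
      exact Real.rpow_le_rpow_of_nonpos (by linarith) hm2 (by linarith)
    _ = A * (m : ℝ) ^ (-r) / 4 := by ring

/-! ### Polynomials, identity and products from finite differences of the activation. -/

lemma exists_two_sided_taylor_bound {f : ℝ → ℝ} (hf : ContDiff ℝ ∞ f) (θ : ℝ) (n : ℕ) (ρ : ℝ) :
    ∃ C : ℝ, 0 ≤ C ∧ ∀ z, |z| ≤ ρ →
      |f (θ + z) - ∑ k ∈ Finset.range (n + 1), iteratedDeriv k f θ / (k.factorial : ℝ) * z ^ k|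
        ≤ C * |z| ^ (n + 1) := by
  have hle : ∀ k : ℕ, (k : WithTop ℕ∞) ≤ ((⊤ : ℕ∞) : WithTop ℕ∞) := fun k => by
    exact_mod_cast le_top
  have hc : Continuous (iteratedDeriv (n + 1) f) := hf.continuous_iteratedDeriv (n + 1) (hle _)
  obtain ⟨C, hC⟩ := (isCompact_Icc (a := θ - ρ) (b := θ + ρ)).exists_bound_of_continuousOn
    hc.continuousOn
  refine ⟨max C 0, le_max_right _ _, fun z hz => ?_⟩
  rcases eq_or_ne z 0 with rfl | hz0
  · rw [Finset.sum_eq_single 0]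
    · simp
    · intro k _ hk
      simp [hk]
    · simp
  have hne : θ ≠ θ + z := by simpa using hz0
  have hcd : ContDiff ℝ ((n : WithTop ℕ∞) + 1) f := by
    have := hf.of_le (hle (n + 1))
    exact_mod_cast this
  obtain ⟨y, hy, hyeq⟩ := taylor_mean_remainder_lagrange_iteratedDeriv hne hcd.contDiffOn
  have hsum : taylorWithinEval f n (Set.uIcc θ (θ + z)) θ (θ + z)
      = ∑ k ∈ Finset.range (n + 1), iteratedDeriv k f θ / (k.factorial : ℝ) * z ^ k := by
    rw [taylor_within_apply]
    refine Finset.sum_congr rfl fun k _ => ?_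
    rw [iteratedDerivWithin_eq_iteratedDeriv (uniqueDiffOn_uIcc hne)
      (hf.of_le (hle k)).contDiffAt Set.left_mem_uIcc, smul_eq_mul, add_sub_cancel_left]
    ring
  rw [hsum, add_sub_cancel_left] at hyeq
  rw [hyeq, abs_div, abs_mul, abs_pow]
  have hfac : (1 : ℝ) ≤ |((n + 1).factorial : ℝ)| := by
    rw [Nat.abs_cast]
    exact_mod_cast Nat.succ_le_of_lt (Nat.factorial_pos _)
  have hyI : y ∈ Set.Icc (θ - ρ) (θ + ρ) := by
    have h1 := Set.mem_uIcc.1 (Set.Ioo_subset_Icc_self hy)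
    have h2 := abs_le.1 hz
    rcases h1 with h | h <;> constructor <;> linarith [h.1, h.2, h2.1, h2.2]
  have hb : |iteratedDeriv (n + 1) f y| ≤ max C 0 := (hC y hyI).trans (le_max_left _ _)
  refine (div_le_self (by positivity) hfac).trans ?_
  gcongr

open Polynomial in
-- Lagrange interpolation at `s + 1` nodes in `[0, 1]` expresses the coefficients linearly through
-- values of the polynomial.
lemma exists_poly_coeff_bound (s : ℕ) : ∃ C : ℝ, 1 ≤ C ∧ ∀ P : ℝ[X], P.natDegree ≤ s → ∀ Q : ℝ,
    (∀ t ∈ Set.Icc (0 : ℝ) 1, |P.eval t| ≤ Q) → ∀ k, |P.coeff k| ≤ C * Q := by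
  let w : Fin (s + 1) → ℝ := fun i => (i : ℕ) / ((s : ℝ) + 1)
  have hw : Set.InjOn w (Finset.univ : Finset (Fin (s + 1))) := by
    intro i _ j _ h
    have h' : ((i : ℕ) : ℝ) / ((s : ℝ) + 1) = (j : ℕ) / ((s : ℝ) + 1) := h
    rw [div_left_inj' (by positivity)] at h'
    exact Fin.ext (by exact_mod_cast h')
  have hwI : ∀ i, w i ∈ Set.Icc (0 : ℝ) 1 := by
    intro i
    refine ⟨by positivity, ?_⟩
    have : ((i : ℕ) : ℝ) < (s : ℝ) + 1 := by exact_mod_cast i.2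
    exact (div_le_one (by positivity)).2 this.le
  refine ⟨1 + ∑ k ∈ Finset.range (s + 1), ∑ i, |(Lagrange.basis Finset.univ w i).coeff k|,
    le_add_of_nonneg_right (by positivity), fun P hP Q hQ k => ?_⟩
  have hQ0 : 0 ≤ Q := (abs_nonneg _).trans (hQ 0 ⟨le_rfl, zero_le_one⟩)
  have hdeg : P.degree < (Finset.univ : Finset (Fin (s + 1))).card := by
    rw [Finset.card_univ, Fintype.card_fin]
    exact lt_of_le_of_lt (degree_le_of_natDegree_le hP) (by exact_mod_cast Nat.lt_succ_self s)
  by_cases hk : k ∈ Finset.range (s + 1)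
  · have h1 : |P.coeff k| ≤ ∑ i, |(Lagrange.basis Finset.univ w i).coeff k| * Q := by
      conv_lhs => rw [Lagrange.eq_interpolate hw hdeg]
      rw [Lagrange.interpolate_apply, finsetSum_coeff]
      refine (Finset.abs_sum_le_sum_abs _ _).trans (Finset.sum_le_sum fun i _ => ?_)
      rw [coeff_C_mul, abs_mul, mul_comm]
      gcongr
      exact hQ _ (hwI i)
    rw [← Finset.sum_mul] at h1
    refine h1.trans ?_
    gcongr
    have := Finset.single_le_sum (s := Finset.range (s + 1))
      (f := fun k => ∑ i, |(Lagrange.basis Finset.univ w i).coeff k|)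
      (fun k _ => by positivity) hk
    linarith
  · rw [coeff_eq_zero_of_natDegree_lt (by rw [Finset.mem_range] at hk; omega), abs_zero]
    positivity

open Polynomial in
-- Interpolation reproduces `X ^ l` exactly; comparing coefficients inverts the Vandermonde matrix
-- of the nodes `0, …, s`.
lemma sum_basis_coeff_mul_pow {s k l : ℕ} (hl : l ≤ s) :
    ∑ i : Fin (s + 1), (Lagrange.basis Finset.univ (fun i : Fin (s + 1) => ((i : ℕ) : ℝ)) i).coeff k
      * ((i : ℕ) : ℝ) ^ l = if k = l then 1 else 0 := by
  have hw : Set.InjOn (fun i : Fin (s + 1) => ((i : ℕ) : ℝ))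
      (Finset.univ : Finset (Fin (s + 1))) := by
    intro i _ j _ h
    have h' : ((i : ℕ) : ℝ) = (j : ℕ) := h
    exact Fin.ext (by exact_mod_cast h')
  have hdeg : (X ^ l : ℝ[X]).degree < (Finset.univ : Finset (Fin (s + 1))).card := by
    rw [Finset.card_univ, Fintype.card_fin, degree_X_pow]
    exact_mod_cast Nat.lt_succ_of_le hl
  have h := congrArg (fun p : ℝ[X] => p.coeff k) (Lagrange.eq_interpolate hw hdeg)
  simp only [Lagrange.interpolate_apply, finsetSum_coeff, coeff_C_mul, coeff_X_pow, eval_pow,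
    eval_X] at h
  rw [h]
  exact Finset.sum_congr rfl fun i _ => mul_comm _ _

open Polynomial in
-- Expanding `φ (i h t + θ)` at `θ`, the inverse Vandermonde weights isolate each power `(h t)^k`,
-- and division by its nonzero Taylor coefficient and by `h^k` yields `t^k`. The weights are
-- `O(h^(-s))` and the Taylor remainder is `O(h^(s+1))`, which leaves `O(h)`.
lemma exists_poly_approx {φ : ℝ → ℝ} (hφ : ContDiff ℝ ∞ φ) (θ : ℝ)
    (hθ : ∀ j, iteratedDeriv j φ θ ≠ 0) (s : ℕ) :
    ∃ C : ℝ, 1 ≤ C ∧ ∀ h : ℝ, 0 < h → h ≤ 1 → ∀ (P : ℝ[X]) (Q : ℝ), P.natDegree ≤ s →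
      (∀ k, |P.coeff k| ≤ Q) → ∃ c : Fin (s + 1) → ℝ, (∀ i, |c i| ≤ C * Q * h⁻¹ ^ s) ∧
        ∀ t ∈ Set.Icc (0 : ℝ) 1,
          |∑ i, c i * φ ((i : ℕ) * h * t + θ) - P.eval t| ≤ C * Q * h := by
  obtain ⟨C₁, hC₁, hT⟩ := exists_two_sided_taylor_bound hφ θ s s
  let ℓ : ℕ → Fin (s + 1) → ℝ := fun k i =>
    (Lagrange.basis Finset.univ (fun i : Fin (s + 1) => ((i : ℕ) : ℝ)) i).coeff k
  let D : ℕ → ℝ := fun k => iteratedDeriv k φ θ / (k.factorial : ℝ)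
  have hD : ∀ k, D k ≠ 0 := fun k => div_ne_zero (hθ k) (by positivity)
  set C₂ := ∑ i, ∑ k ∈ Finset.range (s + 1), |ℓ k i / D k| with hC₂
  have hC₂0 : 0 ≤ C₂ := by positivity
  refine ⟨1 + C₂ + (s + 1) * C₂ * (C₁ * (s : ℝ) ^ (s + 1)), ?_, fun h h0 h1 P Q hP hQ => ?_⟩
  · have : 0 ≤ (s + 1) * C₂ * (C₁ * (s : ℝ) ^ (s + 1)) := by positivity
    linarith
  have hQ0 : 0 ≤ Q := (abs_nonneg _).trans (hQ 0)
  have hinv : 1 ≤ h⁻¹ := (one_le_inv₀ h0).2 h1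
  let c : Fin (s + 1) → ℝ := fun i =>
    ∑ k ∈ Finset.range (s + 1), P.coeff k * h⁻¹ ^ k * (ℓ k i / D k)
  have hc : ∀ i, |c i| ≤ C₂ * Q * h⁻¹ ^ s := by
    intro i
    calc |c i| ≤ ∑ k ∈ Finset.range (s + 1), Q * h⁻¹ ^ s * |ℓ k i / D k| := by
          refine (Finset.abs_sum_le_sum_abs _ _).trans (Finset.sum_le_sum fun k hk => ?_)
          rw [abs_mul, abs_mul, abs_of_pos (by positivity : 0 < h⁻¹ ^ k)]
          have hk' : k ≤ s := Nat.lt_succ_iff.1 (Finset.mem_range.1 hk)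
          gcongr
          exact hQ k
      _ = Q * h⁻¹ ^ s * ∑ k ∈ Finset.range (s + 1), |ℓ k i / D k| := by rw [Finset.mul_sum]
      _ ≤ Q * h⁻¹ ^ s * C₂ := by
          gcongr
          exact Finset.single_le_sum (s := Finset.univ)
            (f := fun i => ∑ k ∈ Finset.range (s + 1), |ℓ k i / D k|)
            (fun i _ => by positivity) (Finset.mem_univ i)
      _ = C₂ * Q * h⁻¹ ^ s := by ring
  have hthird : 0 ≤ (s + 1) * C₂ * (C₁ * (s : ℝ) ^ (s + 1)) := by positivity
  refine ⟨c, fun i => (hc i).trans ?_, fun t ht => ?_⟩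
  · gcongr
    linarith
  have hmain : ∑ i, c i * ∑ l ∈ Finset.range (s + 1), D l * ((i : ℕ) * h * t) ^ l = P.eval t := by
    have e1 : ∀ i, c i * ∑ l ∈ Finset.range (s + 1), D l * ((i : ℕ) * h * t) ^ l
        = ∑ k ∈ Finset.range (s + 1), ∑ l ∈ Finset.range (s + 1),
          P.coeff k * h⁻¹ ^ k / D k * D l * (h * t) ^ l * (ℓ k i * ((i : ℕ) : ℝ) ^ l) := by
      intro i
      rw [Finset.sum_mul_sum]
      refine Finset.sum_congr rfl fun k _ => Finset.sum_congr rfl fun l _ => ?_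
      rw [mul_assoc, mul_pow]
      ring
    rw [Finset.sum_congr rfl fun i _ => e1 i, Finset.sum_comm,
      eval_eq_sum_range' (Nat.lt_succ_of_le hP)]
    refine Finset.sum_congr rfl fun k hk => ?_
    rw [Finset.sum_comm]
    have e2 : ∀ l ∈ Finset.range (s + 1),
        ∑ i, P.coeff k * h⁻¹ ^ k / D k * D l * (h * t) ^ l * (ℓ k i * ((i : ℕ) : ℝ) ^ l)
        = if k = l then P.coeff k * t ^ k else 0 := by
      intro l hl
      rw [← Finset.mul_sum,
        sum_basis_coeff_mul_pow (k := k) (Nat.lt_succ_iff.1 (Finset.mem_range.1 hl))]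
      split_ifs with hkl
      · subst hkl
        have := hD k
        have hh : h⁻¹ ^ k * h ^ k = 1 := by rw [← mul_pow, inv_mul_cancel₀ h0.ne', one_pow]
        calc _ = P.coeff k * t ^ k * (h⁻¹ ^ k * h ^ k) * (D k / D k) := by ring
          _ = _ := by rw [hh, div_self this, mul_one, mul_one]
      · simp
    rw [Finset.sum_congr rfl e2, Finset.sum_ite_eq, if_pos hk]
  rw [← hmain, ← Finset.sum_sub_distrib]
  have hterm : ∀ i : Fin (s + 1), |c i * φ ((i : ℕ) * h * t + θ)
      - c i * ∑ l ∈ Finset.range (s + 1), D l * ((i : ℕ) * h * t) ^ l|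
      ≤ C₂ * (C₁ * (s : ℝ) ^ (s + 1)) * Q * h := by
    intro i
    have hi : ((i : ℕ) : ℝ) ≤ s := by exact_mod_cast Nat.lt_succ_iff.1 i.2
    have hz0 : 0 ≤ ((i : ℕ) : ℝ) * h * t := mul_nonneg (by positivity) ht.1
    have hz1 : ((i : ℕ) : ℝ) * h * t ≤ s * h := by
      have : ((i : ℕ) : ℝ) * h * t ≤ ((i : ℕ) : ℝ) * h * 1 := by gcongr; exact ht.2
      nlinarith
    have hz2 : (s : ℝ) * h ≤ s := by nlinarith [Nat.cast_nonneg (α := ℝ) s]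
    have hzb := hT (((i : ℕ) : ℝ) * h * t) (by rw [abs_of_nonneg hz0]; linarith)
    rw [abs_of_nonneg hz0, add_comm θ] at hzb
    rw [← mul_sub, abs_mul]
    calc _ ≤ (C₂ * Q * h⁻¹ ^ s) * (C₁ * (s * h) ^ (s + 1)) := by
          refine mul_le_mul (hc i) (hzb.trans ?_) (abs_nonneg _) (by positivity)
          gcongr
      _ = C₂ * (C₁ * (s : ℝ) ^ (s + 1)) * Q * h * (h⁻¹ * h) ^ s := by ring
      _ = _ := by rw [inv_mul_cancel₀ h0.ne', one_pow, mul_one]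
  refine (Finset.abs_sum_le_sum_abs _ _).trans ((Finset.sum_le_sum fun i _ => hterm i).trans ?_)
  rw [Finset.sum_const, Finset.card_univ, Fintype.card_fin, nsmul_eq_mul]
  push_cast
  have : (0 : ℝ) ≤ (1 + C₂) * (Q * h) := by positivity
  nlinarith

lemma exists_linear_approx {φ : ℝ → ℝ} (hφ : ContDiff ℝ ∞ φ) (θ : ℝ)
    (hθ : iteratedDeriv 1 φ θ ≠ 0) (Q : ℝ) (hQ : 0 ≤ Q) :
    ∃ C : ℝ, 0 ≤ C ∧ ∀ μ : ℝ, 0 < μ → μ ≤ 1 → ∀ u : ℝ, |u| ≤ Q →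
      |(φ (μ * u + θ) - φ θ) / (μ * iteratedDeriv 1 φ θ) - u| ≤ C * μ := by
  obtain ⟨C, hC0, hC⟩ := exists_two_sided_taylor_bound hφ θ 1 Q
  refine ⟨C * Q ^ 2 / |iteratedDeriv 1 φ θ|, by positivity, fun μ h0 h1 u hu => ?_⟩
  have hz : |μ * u| ≤ Q := by
    rw [abs_mul, abs_of_pos h0]; nlinarith [abs_nonneg u]
  have h := hC _ hz
  simp only [Finset.sum_range_succ, Finset.sum_range_zero, iteratedDeriv_zero, pow_zero,
    Nat.factorial, Nat.cast_one, div_one, mul_one, zero_add, pow_one] at h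
  rw [add_comm θ] at h
  have e : (φ (μ * u + θ) - φ θ) / (μ * iteratedDeriv 1 φ θ) - u
      = (φ (μ * u + θ) - (φ θ + iteratedDeriv 1 φ θ * (μ * u))) / (μ * iteratedDeriv 1 φ θ) := by
    field_simp
    ring
  rw [e, abs_div, abs_mul, abs_of_pos h0]
  norm_num [-iteratedDeriv_one] at h
  rw [← abs_mul, sq_abs] at h
  have hu2 : |μ * u| ^ 2 ≤ μ ^ 2 * Q ^ 2 := by
    rw [abs_mul, abs_of_pos h0, mul_pow]; gcongr
  rw [sq_abs] at hu2
  rw [div_le_iff₀ (by positivity)]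
  calc _ ≤ C * (μ * u) ^ 2 := h
    _ ≤ C * (μ ^ 2 * Q ^ 2) := by gcongr
    _ = _ := by field_simp

/-- The mixed second difference kills the constant, linear and pure square terms, so the cross term
`μ² φ''(θ) u w` leads. -/
lemma exists_product_approx {φ : ℝ → ℝ} (hφ : ContDiff ℝ ∞ φ) (θ : ℝ)
    (hθ : iteratedDeriv 2 φ θ ≠ 0) (Q : ℝ) (hQ : 0 ≤ Q) :
    ∃ C : ℝ, 0 ≤ C ∧ ∀ μ : ℝ, 0 < μ → μ ≤ 1 → ∀ u w : ℝ, |u| ≤ Q → |w| ≤ Q →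
      |(φ (μ * (u + w) + θ) - φ (μ * u + θ) - φ (μ * w + θ) + φ θ) / (μ ^ 2 * iteratedDeriv 2 φ θ)
        - u * w| ≤ C * μ := by
  obtain ⟨C, hC0, hC⟩ := exists_two_sided_taylor_bound hφ θ 2 (2 * Q)
  -- `10 = 2³ + 1 + 1`: cubic remainders at `u + w`, `u` and `w`.
  refine ⟨C * (10 * Q ^ 3) / |iteratedDeriv 2 φ θ|, by positivity, fun μ h0 h1 u w hu hw => ?_⟩
  have key : ∀ q z, |z| ≤ q → q ≤ 2 * Q → |φ (μ * z + θ) - (φ θ + iteratedDeriv 1 φ θ * (μ * z)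
      + iteratedDeriv 2 φ θ / 2 * (μ * z) ^ 2)| ≤ C * (μ ^ 3 * q ^ 3) := by
    intro q z hz hq
    have hz' : |μ * z| ≤ 2 * Q := by
      rw [abs_mul, abs_of_pos h0]; nlinarith [abs_nonneg z]
    have h := hC _ hz'
    simp only [Finset.sum_range_succ, Finset.sum_range_zero, iteratedDeriv_zero, pow_zero,
      Nat.factorial, Nat.cast_one, div_one, mul_one, zero_add, pow_one] at h
    rw [add_comm θ] at h
    norm_num [-iteratedDeriv_one] at h
    refine h.trans ?_
    have : |μ * z| ^ 3 ≤ μ ^ 3 * q ^ 3 := by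
      rw [abs_mul, abs_of_pos h0, mul_pow]; gcongr
    rw [abs_mul] at this
    gcongr
  have k1 := key (2 * Q) (u + w) ((abs_add_le _ _).trans (by linarith)) le_rfl
  have k2 := key Q u hu (by linarith)
  have k3 := key Q w hw (by linarith)
  have e : (φ (μ * (u + w) + θ) - φ (μ * u + θ) - φ (μ * w + θ) + φ θ)
        / (μ ^ 2 * iteratedDeriv 2 φ θ) - u * w
      = (φ (μ * (u + w) + θ) - φ (μ * u + θ) - φ (μ * w + θ) + φ θ
        - iteratedDeriv 2 φ θ * μ ^ 2 * (u * w)) / (μ ^ 2 * iteratedDeriv 2 φ θ) := by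
    field_simp
  rw [e, abs_div, abs_mul, abs_of_pos (by positivity : 0 < μ ^ 2), div_le_iff₀ (by positivity)]
  have e2 : C * (10 * Q ^ 3) / |iteratedDeriv 2 φ θ| * μ * (μ ^ 2 * |iteratedDeriv 2 φ θ|)
      = C * (10 * Q ^ 3) * μ ^ 3 := by field_simp
  rw [e2, abs_le]
  rw [abs_le] at k1 k2 k3
  constructor <;> nlinarith

lemma exists_sigmoid_tail_bound {φ : ℝ → ℝ} (hφ : IsSmoothSigmoidal φ) :
    ∃ C : ℝ, 0 ≤ C ∧ ∀ y, 0 < y → |1 - φ y| ≤ C / y ∧ |φ (-y)| ≤ C / y := by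
  obtain ⟨c₁, h₁⟩ := hφ.left_tail.bound
  obtain ⟨c₂, h₂⟩ := hφ.right_tail.bound
  obtain ⟨y₀, hy₀⟩ := Filter.eventually_atTop.1 (h₁.and h₂)
  -- Below the threshold `y₀` the trivial bound `2` is at most `2 y₀ / y`.
  refine ⟨max (max c₁ c₂) (2 * max y₀ 0), le_max_of_le_right (by positivity), fun y hy => ?_⟩
  rcases le_total y₀ y with h | h
  · obtain ⟨e1, e2⟩ := hy₀ y h
    rw [Real.norm_eq_abs, norm_inv, Real.norm_of_nonneg hy.le, ← div_eq_mul_inv] at e1 e2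
    constructor
    · refine e2.trans ?_
      gcongr
      exact (le_max_right _ _).trans (le_max_left _ _)
    · refine e1.trans ?_
      gcongr
      exact (le_max_left _ _).trans (le_max_left _ _)
  · have h2 : 2 ≤ max (max c₁ c₂) (2 * max y₀ 0) / y := by
      rw [le_div_iff₀ hy]
      refine le_trans ?_ (le_max_right _ _)
      have := le_max_left y₀ 0
      linarith
    have b1 := abs_le.1 (hφ.bounded y)
    have b2 := hφ.bounded (-y)
    refine ⟨le_trans ?_ h2, by linarith⟩
    rw [abs_le]
    constructor <;> linarith

/-! ### Piecewise Taylor polynomials with smoothed switches. -/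

open Polynomial in
lemma exists_antiderivative (P : ℝ[X]) (s : ℕ) (hP : P.natDegree ≤ s) :
    ∃ Q : ℝ[X], Q.natDegree ≤ s + 1 ∧ derivative Q = P := by
  refine ⟨∑ k ∈ Finset.range (s + 1), monomial (k + 1) (P.coeff k / ((k : ℝ) + 1)), ?_, ?_⟩
  · refine natDegree_sum_le_of_forall_le _ _ fun k hk => ?_
    refine (natDegree_monomial_le _).trans ?_
    have := Finset.mem_range.1 hk
    omega
  · rw [derivative_sum]
    conv_rhs => rw [P.as_sum_range' (s + 1) (Nat.lt_succ_of_le hP)]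
    refine Finset.sum_congr rfl fun k _ => ?_
    rw [derivative_monomial]
    push_cast
    rw [div_mul_cancel₀ _ (by positivity)]

open Polynomial in
-- Induction on `s`: integrate the polynomial found for the derivative and match the value at `t₀`.
-- The mean value inequality supplies the extra factor `|t - t₀|` without enlarging `c₀`.
lemma exists_taylor_poly {v c₀ : ℝ} (hc₀ : 0 ≤ c₀) (hv : 0 < v) (s : ℕ) : ∀ g ∈ lipUnit s v c₀,
    ∀ t₀ ∈ Set.Icc (0 : ℝ) 1, ∃ P : ℝ[X], P.natDegree ≤ s ∧
      ∀ t ∈ Set.Icc (0 : ℝ) 1, |g t - P.eval t| ≤ c₀ * |t - t₀| ^ ((s : ℝ) + v) := by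
  induction s with
  | zero =>
    rintro g ⟨-, hg⟩ t₀ ht₀
    refine ⟨C (g t₀), by simp, fun t ht => ?_⟩
    simpa using hg t ht t₀ ht₀
  | succ s ih =>
    rintro g ⟨hg1, hg2⟩ t₀ ht₀
    have hu : UniqueDiffOn ℝ (Set.Icc (0 : ℝ) 1) := uniqueDiffOn_Icc zero_lt_one
    push_cast at hg1
    rw [contDiffOn_succ_iff_derivWithin hu] at hg1
    rw [iteratedDerivWithin_succ'] at hg2
    obtain ⟨P, hP, hPb⟩ := ih _ ⟨hg1.2.2, hg2⟩ t₀ ht₀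
    obtain ⟨Q, hQ, hQP⟩ := exists_antiderivative P s hP
    refine ⟨Q + C (g t₀ - Q.eval t₀), ?_, fun t ht => ?_⟩
    · exact (natDegree_add_le _ _).trans (max_le hQ (by simp))
    have hsub : Set.uIcc t₀ t ⊆ Set.Icc 0 1 := Set.uIcc_subset_Icc ht₀ ht
    have hmv := Convex.norm_image_sub_le_of_norm_hasDerivWithin_le
      (f := fun x => g x - Q.eval x) (f' := fun x => derivWithin g (Set.Icc 0 1) x - P.eval x)
      (s := Set.uIcc t₀ t) (x := t₀) (y := t) (C := c₀ * |t - t₀| ^ ((s : ℝ) + v))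
      (fun x hx => by
        have h1 := ((hg1.1 x (hsub hx)).hasDerivWithinAt).mono hsub
        have h2 := (Q.hasDerivAt x).hasDerivWithinAt (s := Set.uIcc t₀ t)
        rw [hQP] at h2
        exact h1.sub h2)
      (fun x hx => by
        refine (hPb x (hsub hx)).trans ?_
        have : |x - t₀| ≤ |t - t₀| := Set.abs_sub_left_of_mem_uIcc hx
        gcongr)
      (convex_uIcc _ _) Set.left_mem_uIcc Set.right_mem_uIcc
    have e : g t - (Q + C (g t₀ - Q.eval t₀)).eval t
        = g t - Q.eval t - (g t₀ - Q.eval t₀) := by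
      simp; ring
    rw [e]
    refine hmv.trans (le_of_eq ?_)
    rw [Real.norm_eq_abs, mul_assoc]
    congr 1
    push_cast
    rcases eq_or_ne (t - t₀) 0 with h0 | h0
    · rw [h0, abs_zero, mul_zero, Real.zero_rpow (by positivity)]
    · have : 0 < |t - t₀| := abs_pos.2 h0
      rw [show (s : ℝ) + 1 + v = (s : ℝ) + v + 1 by ring, Real.rpow_add_one this.ne']

/-- With `m = ⌊n t⌋`, `y` is close to `P m`, and `P m - P 0` is the sum of the jumps with `j < m`.
Replacing this indicator by `φ` costs little: for `j = m - 1, m` the jump itself is `O(n^(-r))`; for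
all other `j` the argument of `φ` has modulus at least `K / n ≥ n^(r+1)`, so each of the at most `n`
tails is `O(n^(-r-1))`. -/
lemma telescoping_approx {φ : ℝ → ℝ} {Cσ c₀ r K t y : ℝ} (hb : ∀ t, |φ t| ≤ 1) (hCσ : 0 ≤ Cσ)
    (hσ : ∀ y, 0 < y → |1 - φ y| ≤ Cσ / y ∧ |φ (-y)| ≤ Cσ / y) (hc₀ : 0 ≤ c₀) (hr : 0 < r)
    {n : ℕ} (hn : 1 ≤ n) (hK : (n : ℝ) ^ (r + 2) ≤ K) (ht : t ∈ Set.Icc (0 : ℝ) 1) (P : ℕ → ℝ)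
    (hP : ∀ j ≤ n, |y - P j| ≤ c₀ * |t - j / n| ^ r) :
    |y - P 0 - ∑ j ∈ Finset.range n, (P (j + 1) - P j) * φ (K * t - K * (((j : ℝ) + 1) / n))|
      ≤ (c₀ + 4 * c₀ * (1 + 2 ^ r) + 2 * c₀ * Cσ) * (n : ℝ) ^ (-r) := by
  have hnR : (1 : ℝ) ≤ n := by exact_mod_cast hn
  have hn0 : (0 : ℝ) < n := by linarith
  have hK0 : 0 < K := lt_of_lt_of_le (by positivity) hK
  set m := ⌊n * t⌋₊ with hm
  have hnt : 0 ≤ n * t := mul_nonneg hn0.le ht.1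
  have hm1 : (m : ℝ) ≤ n * t := Nat.floor_le hnt
  have hm2 : n * t < m + 1 := Nat.lt_floor_add_one _
  have hmn : m ≤ n := by
    have : (m : ℝ) ≤ n := hm1.trans (by nlinarith [ht.2])
    exact_mod_cast this
  have htel : P m - P 0 = ∑ j ∈ Finset.range n, if j < m then P (j + 1) - P j else 0 := by
    rw [← Finset.sum_range_sub, ← Finset.sum_filter]
    congr 1
    ext j
    simp only [Finset.mem_range, Finset.mem_filter]
    omega
  have habs : ∀ q : ℝ, |t - q / n| = |n * t - q| / n := by
    intro q
    rw [show t - q / n = (n * t - q) / n by field_simp, abs_div, abs_of_pos hn0]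
  have hscale : ∀ q a : ℝ, 0 ≤ a → |n * t - q| ≤ a → |t - q / n| ^ r ≤ a ^ r * (n : ℝ) ^ (-r) := by
    intro q a ha h
    rw [habs, Real.div_rpow (abs_nonneg _) hn0.le, Real.rpow_neg hn0.le, ← div_eq_mul_inv]
    gcongr
  have e : y - P 0 - ∑ j ∈ Finset.range n, (P (j + 1) - P j) * φ (K * t - K * (((j : ℝ) + 1) / n))
      = (y - P m) + ∑ j ∈ Finset.range n, ((if j < m then P (j + 1) - P j else 0)
        - (P (j + 1) - P j) * φ (K * t - K * (((j : ℝ) + 1) / n))) := by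
    rw [Finset.sum_sub_distrib, ← htel]; ring
  have hfirst : |y - P m| ≤ c₀ * (n : ℝ) ^ (-r) := by
    refine (hP m hmn).trans ?_
    have := hscale m 1 zero_le_one (by rw [abs_le]; constructor <;> linarith)
    rw [Real.one_rpow, one_mul] at this
    gcongr
  set E := 2 * c₀ * (1 + 2 ^ r) * (n : ℝ) ^ (-r) with hE
  have hE0 : 0 ≤ E := by positivity
  have hdiff : ∀ j < n, |P (j + 1) - P j|
      ≤ c₀ * |t - ((j : ℝ) + 1) / n| ^ r + c₀ * |t - j / n| ^ r := by
    intro j hj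
    have h1 := hP (j + 1) hj
    have h2 := hP j hj.le
    push_cast at h1
    rw [abs_le] at h1 h2 ⊢
    constructor <;> linarith
  have hterm : ∀ j ∈ Finset.range n, |(if j < m then P (j + 1) - P j else 0)
        - (P (j + 1) - P j) * φ (K * t - K * (((j : ℝ) + 1) / n))|
      ≤ (if j ∈ ({m - 1, m} : Finset ℕ) then E else 0)
        + 2 * c₀ * Cσ * (n : ℝ) ^ (-r) * (n : ℝ)⁻¹ := by
    intro j hj
    have hjn : j < n := Finset.mem_range.1 hj
    have hjR : (j : ℝ) + 1 ≤ n := by exact_mod_cast hjn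
    have hd := hdiff j hjn
    have e3 : (if j < m then P (j + 1) - P j else 0)
        - (P (j + 1) - P j) * φ (K * t - K * (((j : ℝ) + 1) / n))
        = (P (j + 1) - P j) *
          ((if j < m then 1 else 0) - φ (K * t - K * (((j : ℝ) + 1) / n))) := by
      split_ifs <;> ring
    rw [e3, abs_mul]
    have hbφ := abs_le.1 (hb (K * t - K * (((j : ℝ) + 1) / n)))
    have hsec : 0 ≤ 2 * c₀ * Cσ * (n : ℝ) ^ (-r) * (n : ℝ)⁻¹ := by positivity
    by_cases hjm : j ∈ ({m - 1, m} : Finset ℕ)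
    · rw [if_pos hjm]
      have h2 : |(if j < m then (1 : ℝ) else 0) - φ (K * t - K * (((j : ℝ) + 1) / n))| ≤ 2 := by
        rw [abs_le]
        split_ifs <;> constructor <;> linarith
      -- The third case is truncated subtraction: for `m = 0`, also `m - 1 = 0`.
      have hj' : j = m ∨ j + 1 = m ∨ (m = 0 ∧ j = 0) := by
        simp only [Finset.mem_insert, Finset.mem_singleton] at hjm
        omega
      have hj1 : |n * t - ((j : ℝ) + 1)| ≤ 1 ∧ |n * t - j| ≤ 2 := by
        have : (j : ℝ) = m ∨ (j : ℝ) + 1 = m := by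
          rcases hj' with h | h | h
          · left; exact_mod_cast h
          · right; exact_mod_cast h
          · left; rw [h.1, h.2]
        rcases this with h | h <;> constructor <;> rw [abs_le] <;> constructor <;> linarith
      have s1 := hscale _ 1 zero_le_one hj1.1
      have s2 := hscale _ 2 zero_le_two hj1.2
      rw [Real.one_rpow, one_mul] at s1
      have h3 : |P (j + 1) - P j| ≤ c₀ * (1 + 2 ^ r) * (n : ℝ) ^ (-r) := by
        refine hd.trans ?_
        have := mul_le_mul_of_nonneg_left s1 hc₀
        have := mul_le_mul_of_nonneg_left s2 hc₀
        linarith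
      calc _ ≤ c₀ * (1 + 2 ^ r) * (n : ℝ) ^ (-r) * 2 :=
            mul_le_mul h3 h2 (abs_nonneg _) (by positivity)
        _ = E := by rw [hE]; ring
        _ ≤ _ := by linarith
    · rw [if_neg hjm, zero_add]
      simp only [Finset.mem_insert, Finset.mem_singleton, not_or] at hjm
      have hone : ∀ q : ℝ, 0 ≤ q → q ≤ n → |t - q / n| ^ r ≤ 1 := by
        intro q h0 h1
        refine Real.rpow_le_one (abs_nonneg _) ?_ hr.le
        have a1 : 0 ≤ q / n := by positivity
        have a2 : q / n ≤ 1 := (div_le_one hn0).2 h1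
        rw [abs_le]
        constructor <;> linarith [ht.1, ht.2]
      have h3 : |P (j + 1) - P j| ≤ 2 * c₀ := by
        refine hd.trans ?_
        have := mul_le_mul_of_nonneg_left (hone ((j : ℝ) + 1) (by positivity) hjR) hc₀
        have := mul_le_mul_of_nonneg_left (hone j (by positivity) (by linarith)) hc₀
        linarith
      have hKn : (n : ℝ) ^ r * n ≤ K / n := by
        rw [le_div_iff₀ hn0]
        refine le_trans (le_of_eq ?_) hK
        rw [Real.rpow_add hn0, Real.rpow_two]; ring
      have htail : ∀ z, K / n ≤ z → Cσ / z ≤ Cσ * ((n : ℝ) ^ (-r) * (n : ℝ)⁻¹) := by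
        intro z hz
        rw [Real.rpow_neg hn0.le, ← mul_inv, ← div_eq_mul_inv]
        exact div_le_div_of_nonneg_left hCσ (by positivity) (hKn.trans hz)
      have harg : K * t - K * (((j : ℝ) + 1) / n) = K / n * (n * t - (j + 1)) := by field_simp
      have hKn0 : 0 < K / n := by positivity
      have h2 : |(if j < m then (1 : ℝ) else 0) - φ (K * t - K * (((j : ℝ) + 1) / n))|
          ≤ Cσ * ((n : ℝ) ^ (-r) * (n : ℝ)⁻¹) := by
        rw [harg]
        split_ifs with hlt
        · have : (j : ℝ) + 2 ≤ m := by exact_mod_cast (by omega : j + 2 ≤ m)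
          have hge : K / n ≤ K / n * (n * t - (j + 1)) := by nlinarith
          exact (hσ _ (hKn0.trans_le hge)).1.trans (htail _ hge)
        · have : (m : ℝ) + 1 ≤ j := by exact_mod_cast (by omega : m + 1 ≤ j)
          have hge : K / n ≤ K / n * ((j + 1) - n * t) := by nlinarith
          have := (hσ _ (hKn0.trans_le hge)).2.trans (htail _ hge)
          rw [zero_sub, abs_neg]
          rwa [← mul_neg, neg_sub] at this
      calc _ ≤ 2 * c₀ * (Cσ * ((n : ℝ) ^ (-r) * (n : ℝ)⁻¹)) :=
            mul_le_mul h3 h2 (abs_nonneg _) (by positivity)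
        _ = _ := by ring
  have hsum : ∑ j ∈ Finset.range n, ((if j ∈ ({m - 1, m} : Finset ℕ) then E else 0)
        + 2 * c₀ * Cσ * (n : ℝ) ^ (-r) * (n : ℝ)⁻¹) ≤ 2 * E + 2 * c₀ * Cσ * (n : ℝ) ^ (-r) := by
    rw [Finset.sum_add_distrib, Finset.sum_const, Finset.card_range, nsmul_eq_mul]
    refine add_le_add ?_ (le_of_eq (by field_simp))
    rw [← Finset.sum_filter, Finset.sum_const, nsmul_eq_mul]
    gcongr
    have : ((Finset.range n).filter (· ∈ ({m - 1, m} : Finset ℕ))).card ≤ 2 := by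
      refine (Finset.card_le_card (t := {m - 1, m}) fun j hj => ?_).trans Finset.card_le_two
      exact (Finset.mem_filter.1 hj).2
    exact_mod_cast this
  rw [e]
  refine (abs_add_le _ _).trans ?_
  have := (Finset.abs_sum_le_sum_abs _ _).trans ((Finset.sum_le_sum hterm).trans hsum)
  refine (add_le_add hfirst this).trans (le_of_eq ?_)
  rw [hE]; ring

/-! ### Nets for the squared norm and for layer 2. -/

lemma zero_mem_treeNets (d : ℕ) (N : ℕ → ℕ) (φ : ℕ → ℝ → ℝ) {B : ℝ} (hB : 0 ≤ B) (k : ℕ) :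
    (fun _ => 0) ∈ treeNets d N φ B k := by
  induction k with
  | zero => exact ⟨0, 0, 0, fun _ => by simpa using hB, by simp⟩
  | succ k ih => exact ⟨0, 0, fun _ _ => 0, fun _ => by simpa using hB, fun _ => ih, by simp⟩

/-- Lets nodes be indexed by any small enough finite type; unused places are filled with zero
weights and zero subnets. -/
lemma sum_mem_treeNets_succ {d : ℕ} {N : ℕ → ℕ} {φ : ℕ → ℝ → ℝ} {B : ℝ} (hB : 0 ≤ B) {k : ℕ}
    {ι : Type*} [Fintype ι] (hcard : Fintype.card ι ≤ N (k + 1)) {a b : ι → ℝ}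
    {H : ι → EuclideanSpace ℝ (Fin d) → ℝ} (ha : ∀ i, |a i| ≤ B) (hb : ∀ i, |b i| ≤ B)
    (hH : ∀ i, H i ∈ treeNets d N φ B k) :
    (fun x => ∑ i, a i * φ (k + 1) (H i x + b i)) ∈ treeNets d N φ B (k + 1) := by
  obtain ⟨e⟩ : Nonempty (ι ↪ Fin (N (k + 1))) :=
    Function.Embedding.nonempty_of_card_le (by simpa using hcard)
  have hext : ∀ {γ : Type} (p : γ → Prop) (u : ι → γ) (z : γ), (∀ i, p (u i)) → p z →
      ∀ j, p (Function.extend e u (fun _ => z) j) := by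
    intro γ p u z hu hz j
    by_cases h : ∃ i, e i = j
    · obtain ⟨i, rfl⟩ := h
      rw [e.injective.extend_apply]
      exact hu i
    · rw [Function.extend_apply' _ _ _ h]
      exact hz
  refine ⟨Function.extend e a (fun _ => 0), Function.extend e b (fun _ => 0),
    Function.extend e H (fun _ _ => 0),
    fun j => ⟨hext (fun z => |z| ≤ B) a 0 ha (by simpa using hB) j,
      hext (fun z => |z| ≤ B) b 0 hb (by simpa using hB) j⟩,
    hext (fun h => h ∈ treeNets d N φ B k) H _ hH (zero_mem_treeNets d N φ hB k), ?_⟩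
  funext x
  refine Fintype.sum_of_injective e e.injective _ _ (fun j hj => ?_) fun i => ?_
  · rw [Function.extend_apply' a _ _ (by simpa using hj), zero_mul]
  · rw [e.injective.extend_apply, e.injective.extend_apply, e.injective.extend_apply]

/-- The sums over `φ (± h x_i + θ)` together cancel odd terms and leave `φ''(θ) h² |x|²`. The outer
`φ` must pass these sums through almost linearly: at scale `h²` its relative error is `O(h²)`, still
`O(h)` after division by `h φ''(θ)`. -/
lemma sum_linearized_approx {φ : ℝ → ℝ} (hφ : IsSmoothSigmoidal φ) (θ : ℝ)
    (h1 : iteratedDeriv 1 φ θ ≠ 0) (h2 : iteratedDeriv 2 φ θ ≠ 0) (d : ℕ) :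
    ∃ C : ℝ, 0 ≤ C ∧ ∀ h : ℝ, 0 < h → h ≤ 1 →
      ∀ x ∈ Metric.closedBall (0 : EuclideanSpace ℝ (Fin d)) 1,
        |(φ (∑ i, h * φ (h * x i + θ) + (θ - h * d * φ θ))
          + φ (∑ i, h * φ (-h * x i + θ) + (θ - h * d * φ θ)) - 2 * φ θ)
          / (h ^ 3 * iteratedDeriv 1 φ θ * iteratedDeriv 2 φ θ) - ‖x‖ ^ 2| ≤ C * h := by
  obtain ⟨C₁, hC₁, hlin⟩ := exists_linear_approx hφ.smooth θ h1 d (Nat.cast_nonneg d)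
  obtain ⟨C₂, hC₂, hT⟩ := exists_two_sided_taylor_bound hφ.smooth θ 2 1
  set D₁ := iteratedDeriv 1 φ θ with hD₁
  set D₂ := iteratedDeriv 2 φ θ with hD₂
  refine ⟨(2 * C₁ + d * (2 * C₂)) / |D₂|, by positivity, fun h h0 hle x hx => ?_⟩
  have hx1 : ‖x‖ ≤ 1 := by simpa using hx
  have hxi : ∀ i, |x i| ≤ 1 := fun i => (PiLp.norm_apply_le x i).trans hx1
  let Wf : ℝ → ℝ := fun ε => ∑ i, (φ (ε * h * x i + θ) - φ θ) / h
  have hW : ∀ ε, |ε| = 1 → |Wf ε| ≤ d := by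
    intro ε hε
    refine (Finset.abs_sum_le_sum_abs _ _).trans
      ((Finset.sum_le_sum (g := fun _ => (1 : ℝ)) fun i _ => ?_).trans (by simp))
    rw [abs_div, abs_of_pos h0, div_le_one h0]
    refine (hφ.abs_sub_le _ _).trans ?_
    rw [add_sub_cancel_right, abs_mul, abs_mul, hε, abs_of_pos h0]
    nlinarith [hxi i]
  -- The bias removes the constant terms `h φ(θ)` of the inner sum and recentres it at `θ`.
  have harg : ∀ ε, ∑ i, h * φ (ε * h * x i + θ) + (θ - h * d * φ θ) = h ^ 2 * Wf ε + θ := by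
    intro ε
    have : h ^ 2 * Wf ε = ∑ i, (h * φ (ε * h * x i + θ) - h * φ θ) := by
      rw [Finset.mul_sum]
      refine Finset.sum_congr rfl fun i _ => ?_
      field_simp
    rw [this, Finset.sum_sub_distrib, Finset.sum_const, Finset.card_univ, Fintype.card_fin,
      nsmul_eq_mul]
    ring
  have hY : ∀ ε, |ε| = 1 → |(φ (h ^ 2 * Wf ε + θ) - φ θ) / (h ^ 2 * D₁) - Wf ε| ≤ C₁ * h ^ 2 :=
    fun ε hε => hlin (h ^ 2) (by positivity) (pow_le_one₀ h0.le hle) _ (hW ε hε)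
  have hsq : |Wf 1 + Wf (-1) - D₂ * h * ‖x‖ ^ 2| ≤ d * (2 * C₂) * h ^ 2 := by
    rw [EuclideanSpace.real_norm_sq_eq, Finset.mul_sum, ← Finset.sum_add_distrib,
      ← Finset.sum_sub_distrib]
    refine (Finset.abs_sum_le_sum_abs _ _).trans
      ((Finset.sum_le_sum (g := fun _ => 2 * C₂ * h ^ 2) fun i _ => ?_).trans (by simp; linarith))
    have key : ∀ ε, |ε| = 1 → |φ (ε * h * x i + θ) - (φ θ + D₁ * (ε * h * x i)
        + D₂ / 2 * (ε * h * x i) ^ 2)| ≤ C₂ * h ^ 3 := by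
      intro ε hε
      have hz : |ε * h * x i| ≤ h := by
        rw [abs_mul, abs_mul, hε, abs_of_pos h0]
        nlinarith [hxi i]
      have := hT _ (hz.trans hle)
      simp only [Finset.sum_range_succ, Finset.sum_range_zero, iteratedDeriv_zero, pow_zero,
        Nat.factorial, Nat.cast_one, div_one, mul_one, zero_add, pow_one] at this
      rw [add_comm θ] at this
      norm_num [-iteratedDeriv_one, -abs_mul] at this
      rw [← hD₁, ← hD₂] at this
      refine this.trans ?_
      have : |ε * h * x i| ^ 3 ≤ h ^ 3 := by gcongr
      gcongr
    have k1 := key 1 (by simp)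
    have k2 := key (-1) (by simp)
    have e : (φ (1 * h * x i + θ) - φ θ) / h + (φ (-1 * h * x i + θ) - φ θ) / h
        - D₂ * h * x i ^ 2
        = (φ (1 * h * x i + θ) - φ θ + (φ (-1 * h * x i + θ) - φ θ) - D₂ * h ^ 2 * x i ^ 2) / h := by
      field_simp
    rw [e, abs_div, abs_of_pos h0, div_le_iff₀ h0, abs_le]
    rw [abs_le] at k1 k2
    constructor <;> nlinarith
  have e1 := harg 1
  have e2 := harg (-1)
  rw [one_mul] at e1
  rw [neg_one_mul] at e2
  rw [e1, e2]
  have y1 := hY 1 (by simp)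
  have y2 := hY (-1) (by simp)
  have e3 : (φ (h ^ 2 * Wf 1 + θ) + φ (h ^ 2 * Wf (-1) + θ) - 2 * φ θ) / (h ^ 3 * D₁ * D₂)
      - ‖x‖ ^ 2
      = (((φ (h ^ 2 * Wf 1 + θ) - φ θ) / (h ^ 2 * D₁) - Wf 1)
        + ((φ (h ^ 2 * Wf (-1) + θ) - φ θ) / (h ^ 2 * D₁) - Wf (-1))
        + (Wf 1 + Wf (-1) - D₂ * h * ‖x‖ ^ 2)) / (h * D₂) := by
    field_simp
    ring
  rw [e3, abs_div, abs_mul h, abs_of_pos h0, div_le_iff₀ (by positivity)]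
  have e4 : (2 * C₁ + d * (2 * C₂)) / |D₂| * h * (h * |D₂|)
      = (2 * C₁ + d * (2 * C₂)) * h ^ 2 := by field_simp
  rw [e4, abs_le]
  rw [abs_le] at y1 y2 hsq
  constructor <;> linarith

/-- One `τ` serves every factor `lam`, so all nodes of layer 2 see the same perturbed argument. The
outer weights scale as `lam / h³` with `h` proportional to `δ`, hence `δ⁻¹ ^ 3`. The third node
carries the constant `-2 φ(θ)`. -/
lemma exists_norm_sq_net {φ : ℝ → ℝ} (hφ : IsSmoothSigmoidal φ) (θ : ℝ)
    (h1 : iteratedDeriv 1 φ θ ≠ 0) (h2 : iteratedDeriv 2 φ θ ≠ 0) (d : ℕ) :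
    ∃ C : ℝ, 1 ≤ C ∧ ∀ δ : ℝ, 0 < δ → δ ≤ 1 → ∃ τ : EuclideanSpace ℝ (Fin d) → ℝ,
      (∀ x ∈ Metric.closedBall (0 : EuclideanSpace ℝ (Fin d)) 1, |τ x - ‖x‖ ^ 2| ≤ δ) ∧
      ∀ (N : ℕ → ℕ) (B lam : ℝ), 3 ≤ N 1 → C ≤ B → C * δ⁻¹ ^ 3 * |lam| ≤ B →
        (fun x => lam * τ x) ∈ treeNets d N (fun _ => φ) B 1 := by
  obtain ⟨C₁, hC₁, hap⟩ := sum_linearized_approx hφ θ h1 h2 d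
  set D₁ := iteratedDeriv 1 φ θ with hD₁
  set D₂ := iteratedDeriv 2 φ θ with hD₂
  have hD₁p : 0 < |D₁| := abs_pos.2 h1
  have hD₂p : 0 < |D₂| := abs_pos.2 h2
  refine ⟨1 + d + |θ| + 2 * (C₁ + 1) ^ 3 / (|D₁| * |D₂|), ?_, fun δ hδ hδ1 => ?_⟩
  · have : 0 ≤ 2 * (C₁ + 1) ^ 3 / (|D₁| * |D₂|) := by positivity
    have := abs_nonneg θ
    have : (0 : ℝ) ≤ d := Nat.cast_nonneg d
    linarith
  set h := δ / (C₁ + 1) with hh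
  have h0 : 0 < h := by positivity
  have hle : h ≤ 1 := (div_le_one (by positivity)).2 (by linarith)
  refine ⟨fun x => (φ (∑ i, h * φ (h * x i + θ) + (θ - h * d * φ θ))
          + φ (∑ i, h * φ (-h * x i + θ) + (θ - h * d * φ θ)) - 2 * φ θ)
          / (h ^ 3 * D₁ * D₂), fun x hx => (hap h h0 hle x hx).trans ?_, ?_⟩
  · calc C₁ * h ≤ (C₁ + 1) * h := by gcongr; linarith
      _ = δ := by rw [hh]; field_simp
  intro N B lam hN hCB hB
  have hθ0 := abs_nonneg θ
  have hd0 : (0 : ℝ) ≤ d := Nat.cast_nonneg d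
  have hlast : 0 ≤ 2 * (C₁ + 1) ^ 3 / (|D₁| * |D₂|) := by positivity
  have hB1 : 1 ≤ B := by linarith
  have hb : |θ - h * d * φ θ| ≤ B := by
    have : |h * d * φ θ| ≤ d := by
      rw [abs_mul, abs_of_nonneg (by positivity)]
      have := hφ.bounded θ
      have : h * d ≤ 1 * d := by gcongr
      nlinarith [abs_nonneg (φ θ), mul_nonneg h0.le hd0]
    exact (abs_sub _ _).trans (by linarith)
  have ha : |lam / (h ^ 3 * D₁ * D₂)| * 2 ≤ B := by
    refine le_trans (le_trans (le_of_eq ?_) (?_ : 2 * (C₁ + 1) ^ 3 / (|D₁| * |D₂|) * δ⁻¹ ^ 3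
      * |lam| ≤ _)) hB
    · rw [abs_div, abs_mul, abs_mul, abs_of_pos (by positivity : 0 < h ^ 3), hh]
      field_simp
    · gcongr
      linarith
  have hH : ∀ ε : ℝ, |ε| = 1 → (fun x : EuclideanSpace ℝ (Fin d) =>
      ∑ i, h * φ (ε * h * x i + θ)) ∈ treeNets d N (fun _ => φ) B 0 := by
    intro ε hε
    refine ⟨fun _ => h, fun _ => ε * h, fun _ => θ, fun j => ⟨?_, ?_, by linarith⟩, rfl⟩
    · rw [abs_of_pos h0]; linarith
    · rw [abs_mul, hε, abs_of_pos h0]; linarith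
  have hmem := sum_mem_treeNets_succ (φ := fun _ => φ) (N := N) (k := 0) (ι := Fin 3)
    (by linarith : 0 ≤ B) (by simpa using hN)
    (a := fun i => lam / (h ^ 3 * D₁ * D₂) * ![1, 1, -2] i)
    (b := ![θ - h * d * φ θ, θ - h * d * φ θ, θ])
    (H := ![fun x => ∑ i, h * φ (1 * h * x i + θ), fun x => ∑ i, h * φ (-1 * h * x i + θ),
      fun _ => 0])
    (fun i => by
      have := abs_nonneg (lam / (h ^ 3 * D₁ * D₂))
      rw [abs_mul]
      fin_cases i <;> simp <;> linarith)
    (fun i => by fin_cases i <;> simp [hb]; linarith)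
    (fun i => by
      fin_cases i
      · exact hH 1 (by simp)
      · exact hH (-1) (by simp)
      · exact zero_mem_treeNets d N _ (by linarith) 0)
  convert hmem using 1
  funext x
  simp [Fin.sum_univ_three]
  ring

lemma two_layer_mem_treeNets {φ : ℝ → ℝ} {d s : ℕ} {N : ℕ → ℕ} {B : ℝ} (hB : 0 ≤ B)
    (hN : s + 2 ≤ N 2) {τ : EuclideanSpace ℝ (Fin d) → ℝ} {h K θ e a b : ℝ} {c : Fin (s + 1) → ℝ}
    (hh : ∀ i : Fin (s + 1), (fun x => ((i : ℕ) * h) * τ x) ∈ treeNets d N (fun _ => φ) B 1)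
    (hK : (fun x => K * τ x) ∈ treeNets d N (fun _ => φ) B 1)
    (hc : ∀ i, |a * c i| ≤ B) (hb : |b| ≤ B) (hθ : |θ| ≤ B) (he : |e| ≤ B) :
    (fun x => a * ∑ i, c i * φ ((i : ℕ) * h * τ x + θ) + b * φ (K * τ x - e))
      ∈ treeNets d N (fun _ => φ) B 2 := by
  have hmem := sum_mem_treeNets_succ (φ := fun _ => φ) (N := N) (k := 1)
    (ι := Option (Fin (s + 1))) hB (by simp; omega)
    (a := fun i => i.elim b (fun i => a * c i))
    (b := fun i => i.elim (-e) (fun _ => θ))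
    (H := fun i => i.elim (fun x => K * τ x) (fun i x => ((i : ℕ) * h) * τ x))
    (fun i => by cases i with
      | none => exact hb
      | some i => exact hc i)
    (fun i => by cases i with
      | none => simpa using he
      | some i => exact hθ)
    (fun i => by cases i with
      | none => exact hK
      | some i => exact hh i)
  convert hmem using 1
  funext x
  rw [Fintype.sum_option, Finset.mul_sum]
  simp only [Option.elim]
  rw [add_comm, sub_eq_add_neg]
  congr 1
  exact Finset.sum_congr rfl fun i _ => by ring

/-! ### The spline net. -/

open Polynomial in
-- Adds stability in the argument: weights of size `ρ^(-s)` are harmless against a perturbation of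
-- size `ρ^(s+3)`.
lemma exists_poly_node_approx {φ : ℝ → ℝ} (hφ : IsSmoothSigmoidal φ) (θ : ℝ)
    (hθ : ∀ j, iteratedDeriv j φ θ ≠ 0) (s : ℕ) (Q : ℝ) (hQ : 0 ≤ Q) :
    ∃ C : ℝ, 1 ≤ C ∧ ∀ ρ : ℝ, 0 < ρ → ρ ≤ 1 → ∀ P : ℝ[X], P.natDegree ≤ s →
      (∀ t ∈ Set.Icc (0 : ℝ) 1, |P.eval t| ≤ Q) →
      ∃ c : Fin (s + 1) → ℝ, (∀ i, |c i| ≤ C * ρ⁻¹ ^ s) ∧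
        ∀ t ∈ Set.Icc (0 : ℝ) 1, ∀ τ, |τ - t| ≤ ρ ^ (s + 3) →
          |∑ i, c i * φ ((i : ℕ) * ρ * τ + θ) - P.eval t| ≤ C * ρ := by
  obtain ⟨C₁, hC₁, hcoef⟩ := exists_poly_coeff_bound s
  obtain ⟨C₂, hC₂, happ⟩ := exists_poly_approx hφ.smooth θ hθ s
  set A := C₂ * (C₁ * Q) with hA
  have hA0 : 0 ≤ A := by positivity
  refine ⟨1 + A + (s + 1) * s * A, ?_, fun ρ h0 h1 P hP hPQ => ?_⟩
  · have : 0 ≤ (s + 1) * s * A := by positivity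
    linarith
  have hextra : 0 ≤ (s + 1) * s * A := by positivity
  obtain ⟨c, hc, hcb⟩ := happ ρ h0 h1 P (C₁ * Q) hP (hcoef P hP Q hPQ)
  refine ⟨c, fun i => (hc i).trans ?_, fun t ht τ hτ => ?_⟩
  · gcongr
    linarith
  have hterm : ∀ i : Fin (s + 1), |c i * φ ((i : ℕ) * ρ * τ + θ) - c i * φ ((i : ℕ) * ρ * t + θ)|
      ≤ s * A * ρ := by
    intro i
    have hi : ((i : ℕ) : ℝ) ≤ s := by exact_mod_cast Nat.lt_succ_iff.1 i.2
    have hl : |φ ((i : ℕ) * ρ * τ + θ) - φ ((i : ℕ) * ρ * t + θ)| ≤ s * ρ * ρ ^ (s + 3) := by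
      refine (hφ.abs_sub_le _ _).trans ?_
      rw [add_sub_add_right_eq_sub, ← mul_sub, abs_mul, abs_of_nonneg (by positivity)]
      gcongr
    rw [← mul_sub, abs_mul]
    calc _ ≤ (A * ρ⁻¹ ^ s) * (s * ρ * ρ ^ (s + 3)) :=
          mul_le_mul (hc i) hl (abs_nonneg _) (by positivity)
      _ = s * A * ρ * ρ ^ 3 * (ρ⁻¹ * ρ) ^ s := by ring
      _ = s * A * ρ * ρ ^ 3 := by rw [inv_mul_cancel₀ h0.ne', one_pow, mul_one]
      _ ≤ s * A * ρ * 1 := by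
          gcongr
          exact pow_le_one₀ h0.le h1
      _ = s * A * ρ := mul_one _
  have hs := abs_sum_sub_sum_le hterm
  have hb := hcb t ht
  push_cast at hs
  rw [← hA] at hb
  have e : ∑ i, c i * φ ((i : ℕ) * ρ * τ + θ) - P.eval t
      = (∑ i, c i * φ ((i : ℕ) * ρ * τ + θ) - ∑ i, c i * φ ((i : ℕ) * ρ * t + θ))
        + (∑ i, c i * φ ((i : ℕ) * ρ * t + θ) - P.eval t) := by ring
  rw [e]
  refine (abs_add_le _ _).trans ?_
  nlinarith

/-- The univariate function `τ ↦ ∑ i, c i * φ (i ρ τ + θ)`, which stands for a polynomial. -/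
noncomputable def polyNode (φ : ℝ → ℝ) (θ ρ : ℝ) {s : ℕ} (c : Fin (s + 1) → ℝ) (τ : ℝ) : ℝ :=
  ∑ i, c i * φ ((i : ℕ) * ρ * τ + θ)

/-- The univariate function `φ (ρ⁻² (τ - q))`, which stands for a step at `q`. -/
noncomputable def stepNode (φ : ℝ → ℝ) (ρ q τ : ℝ) : ℝ :=
  φ (ρ⁻¹ ^ 2 * τ - ρ⁻¹ ^ 2 * q)

/-- The univariate net that stands for a piecewise polynomial with knots `1 / n, …, n / n`, given
by its first piece and by its jumps. -/
noncomputable def splineNet (φ : ℝ → ℝ) (θ ρ : ℝ) (n : ℕ) {s : ℕ} (c : ℕ → Fin (s + 1) → ℝ)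
    (τ : ℝ) : ℝ :=
  (φ (ρ * polyNode φ θ ρ (c 0) τ + θ) - φ θ) / (ρ * iteratedDeriv 1 φ θ) +
    ∑ j ∈ Finset.range n,
      (φ (ρ * (polyNode φ θ ρ (c (j + 1)) τ + stepNode φ ρ (((j : ℝ) + 1) / n) τ) + θ)
        - φ (ρ * polyNode φ θ ρ (c (j + 1)) τ + θ)
        - φ (ρ * stepNode φ ρ (((j : ℝ) + 1) / n) τ + θ) + φ θ) / (ρ ^ 2 * iteratedDeriv 2 φ θ)

open Polynomial in
lemma exists_splineNet_approx {φ : ℝ → ℝ} (hφ : IsSmoothSigmoidal φ) (θ : ℝ)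
    (hθ : ∀ j, iteratedDeriv j φ θ ≠ 0) (s : ℕ) (v r c₀ M : ℝ) (hv₀ : 0 < v) (hr : r = s + v)
    (hc₀ : 0 < c₀) (hM : 0 < M) :
    ∃ C : ℝ, 1 ≤ C ∧ ∀ (n : ℕ) (ρ : ℝ), 1 ≤ n → ρ = (n : ℝ) ^ (-(r + 1)) →
      ∀ g ∈ lipUnit s v c₀, (∀ t ∈ Set.Icc (0 : ℝ) 1, |g t| ≤ M) →
      ∃ c : ℕ → Fin (s + 1) → ℝ, (∀ j i, |c j i| ≤ C * ρ⁻¹ ^ s) ∧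
        ∀ t ∈ Set.Icc (0 : ℝ) 1, ∀ τ, |τ - t| ≤ ρ ^ (s + 3) →
          |splineNet φ θ ρ n c τ - g t| ≤ C * (n : ℝ) ^ (-r) := by
  have hr0 : 0 < r := by rw [hr]; positivity
  -- Bounds both the first piece (by `M + c₀`) and the jumps (by `2 c₀`).
  set Q := M + 2 * c₀ with hQ
  have hQ0 : 0 < Q := by positivity
  obtain ⟨Cu, hCu, hpoly⟩ := exists_poly_node_approx hφ θ hθ s Q hQ0.le
  obtain ⟨Cσ, hCσ, hσ⟩ := exists_sigmoid_tail_bound hφ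
  obtain ⟨Cp, hCp, hprod⟩ := exists_product_approx hφ.smooth θ (hθ 2) (Q + Cu) (by positivity)
  obtain ⟨Cl, hCl, hlin⟩ := exists_linear_approx hφ.smooth θ (hθ 1) (Q + Cu) (by positivity)
  set Ct := c₀ + 4 * c₀ * (1 + 2 ^ r) + 2 * c₀ * Cσ with hCt
  have hCt0 : 0 ≤ Ct := by positivity
  refine ⟨Cu + (Cl + Cu) + (Cp + Cu + Q) + Ct, by linarith, fun n ρ hn hρ g hg hgM => ?_⟩
  have hnR : (1 : ℝ) ≤ n := by exact_mod_cast hn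
  have hn0 : (0 : ℝ) < n := by linarith
  have hρ0 : 0 < ρ := by rw [hρ]; positivity
  have hρ1 : ρ ≤ 1 := by
    rw [hρ]; exact Real.rpow_le_one_of_one_le_of_nonpos hnR (by linarith)
  have hnρ : n * ρ = (n : ℝ) ^ (-r) := by
    rw [hρ, mul_comm, ← Real.rpow_add_one hn0.ne']
    congr 1; ring
  have hρn : ρ ≤ (n : ℝ) ^ (-r) := by rw [← hnρ]; nlinarith
  have hexP : ∀ j : ℕ, ∃ P : ℝ[X], P.natDegree ≤ s ∧
      (j ≤ n → ∀ t ∈ Set.Icc (0 : ℝ) 1, |g t - P.eval t| ≤ c₀ * |t - j / n| ^ r) := by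
    intro j
    by_cases hj : j ≤ n
    · have hjR : (j : ℝ) ≤ n := by exact_mod_cast hj
      obtain ⟨P, h1, h2⟩ := exists_taylor_poly hc₀.le hv₀ s g hg (j / n)
        ⟨by positivity, (div_le_one hn0).2 hjR⟩
      exact ⟨P, h1, fun _ => by rw [hr]; exact h2⟩
    · exact ⟨0, by simp, fun h => absurd h hj⟩
  choose P hPd hPb using hexP
  have hunit : ∀ j : ℕ, j ≤ n → ∀ t ∈ Set.Icc (0 : ℝ) 1, |g t - (P j).eval t| ≤ c₀ := by
    intro j hj t ht
    have hjR : (j : ℝ) ≤ n := by exact_mod_cast hj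
    refine (hPb j hj t ht).trans (mul_le_of_le_one_right hc₀.le ?_)
    refine Real.rpow_le_one (abs_nonneg _) ?_ hr0.le
    have a1 : 0 ≤ (j : ℝ) / n := by positivity
    have a2 : (j : ℝ) / n ≤ 1 := (div_le_one hn0).2 hjR
    rw [abs_le]
    constructor <;> linarith [ht.1, ht.2]
  -- Index `0` is the first piece and `j + 1` the jump from `P j` to `P (j + 1)`. Beyond `n` the
  -- weights below are set to zero, so that their bound holds for all indices.
  let D : ℕ → ℝ[X] := fun j => Nat.casesOn j (P 0) fun j => P (j + 1) - P j
  have hDd : ∀ j, (D j).natDegree ≤ s := by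
    rintro (_ | j)
    · exact hPd 0
    · exact (natDegree_sub_le _ _).trans (max_le (hPd _) (hPd _))
  have hDQ : ∀ j ≤ n, ∀ t ∈ Set.Icc (0 : ℝ) 1, |(D j).eval t| ≤ Q := by
    rintro (_ | j) hj t ht
    · have h1 := abs_le.1 (hunit 0 hj t ht)
      have h2 := abs_le.1 (hgM t ht)
      show |(P 0).eval t| ≤ Q
      rw [abs_le]; constructor <;> linarith
    · have h1 := abs_le.1 (hunit (j + 1) hj t ht)
      have h2 := abs_le.1 (hunit j (by omega) t ht)
      show |(P (j + 1) - P j).eval t| ≤ Q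
      rw [eval_sub, abs_le]; constructor <;> linarith
  have hexc : ∀ j, ∃ c : Fin (s + 1) → ℝ, (∀ i, |c i| ≤ Cu * ρ⁻¹ ^ s) ∧ (j ≤ n →
      ∀ t ∈ Set.Icc (0 : ℝ) 1, ∀ τ, |τ - t| ≤ ρ ^ (s + 3) →
        |polyNode φ θ ρ c τ - (D j).eval t| ≤ Cu * ρ) := by
    intro j
    by_cases hj : j ≤ n
    · obtain ⟨c, h1, h2⟩ := hpoly ρ hρ0 hρ1 (D j) (hDd j) (hDQ j hj)
      exact ⟨c, h1, fun _ => h2⟩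
    · exact ⟨0, fun i => by simp; positivity, fun h => absurd h hj⟩
  choose c hcb hc using hexc
  refine ⟨c, fun j i => (hcb j i).trans ?_, fun t ht τ hτ => ?_⟩
  · gcongr
    linarith
  have hnode : ∀ j ≤ n, |polyNode φ θ ρ (c j) τ| ≤ Q + Cu := by
    intro j hj
    have h1 := abs_le.1 (hc j hj t ht τ hτ)
    have h2 := abs_le.1 (hDQ j hj t ht)
    have h3 : Cu * ρ ≤ Cu := by nlinarith
    rw [abs_le]; constructor <;> linarith
  have hQ1 : 1 ≤ Q + Cu := by linarith
  -- the first piece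
  have hfirst : |(φ (ρ * polyNode φ θ ρ (c 0) τ + θ) - φ θ) / (ρ * iteratedDeriv 1 φ θ)
      - (P 0).eval t| ≤ (Cl + Cu) * ρ := by
    have h1 := hlin ρ hρ0 hρ1 _ (hnode 0 (by omega))
    have h2 : |polyNode φ θ ρ (c 0) τ - (P 0).eval t| ≤ Cu * ρ := hc 0 (by omega) t ht τ hτ
    have := (abs_add_le _ _).trans (add_le_add h1 h2)
    rw [sub_add_sub_cancel] at this
    linarith
  -- the jumps
  have hjump : ∀ j ∈ Finset.range n,
      |(φ (ρ * (polyNode φ θ ρ (c (j + 1)) τ + stepNode φ ρ (((j : ℝ) + 1) / n) τ) + θ)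
        - φ (ρ * polyNode φ θ ρ (c (j + 1)) τ + θ)
        - φ (ρ * stepNode φ ρ (((j : ℝ) + 1) / n) τ + θ) + φ θ) / (ρ ^ 2 * iteratedDeriv 2 φ θ)
        - ((P (j + 1)).eval t - (P j).eval t)
          * φ (ρ⁻¹ ^ 2 * t - ρ⁻¹ ^ 2 * (((j : ℝ) + 1) / n))| ≤ (Cp + Cu + Q) * ρ := by
    intro j hj
    have hjn : j + 1 ≤ n := Finset.mem_range.1 hj
    have hw : |stepNode φ ρ (((j : ℝ) + 1) / n) τ| ≤ 1 := hφ.bounded _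
    have h1 := hprod ρ hρ0 hρ1 _ _ (hnode (j + 1) hjn) (hw.trans hQ1)
    have h2 := hc (j + 1) hjn t ht τ hτ
    -- The slope `ρ⁻¹ ^ 2` turns the perturbation `ρ^(s+3)` into `ρ^(s+1) ≤ ρ`; this is what the
    -- tolerance `ρ^(s+3)` is made for.
    have h3 : |stepNode φ ρ (((j : ℝ) + 1) / n) τ
        - φ (ρ⁻¹ ^ 2 * t - ρ⁻¹ ^ 2 * (((j : ℝ) + 1) / n))| ≤ ρ := by
      refine (hφ.abs_sub_le _ _).trans ?_
      rw [sub_sub_sub_cancel_right, ← mul_sub, abs_mul, abs_of_pos (by positivity)]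
      calc ρ⁻¹ ^ 2 * |τ - t| ≤ ρ⁻¹ ^ 2 * ρ ^ (s + 3) := by gcongr
        _ = ρ * ρ ^ s * (ρ⁻¹ * ρ) ^ 2 := by ring
        _ = ρ * ρ ^ s := by rw [inv_mul_cancel₀ hρ0.ne', one_pow, mul_one]
        _ ≤ ρ * 1 := by gcongr; exact pow_le_one₀ hρ0.le hρ1
        _ = ρ := mul_one _
    have h4 : |(D (j + 1)).eval t| ≤ Q := hDQ (j + 1) hjn t ht
    have hDe : (D (j + 1)).eval t = (P (j + 1)).eval t - (P j).eval t := eval_sub ..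
    rw [← hDe]
    set u := polyNode φ θ ρ (c (j + 1)) τ
    set w := stepNode φ ρ (((j : ℝ) + 1) / n) τ
    set w' := φ (ρ⁻¹ ^ 2 * t - ρ⁻¹ ^ 2 * (((j : ℝ) + 1) / n))
    have h5 : |u * w - (D (j + 1)).eval t * w'| ≤ Cu * ρ + Q * ρ :=
      abs_mul_sub_mul_le h2 h4 hw h3
    have := (abs_add_le _ _).trans (add_le_add h1 h5)
    rw [sub_add_sub_cancel] at this
    linarith
  -- The steepness is `n^(2(r+1))`, enough because `2(r+1) ≥ r + 2`.
  have hK : (n : ℝ) ^ (r + 2) ≤ ρ⁻¹ ^ 2 := by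
    rw [hρ, Real.rpow_neg hn0.le, inv_inv, ← Real.rpow_mul_natCast hn0.le]
    apply Real.rpow_le_rpow_of_exponent_le hnR
    push_cast
    linarith
  have htele := telescoping_approx hφ.bounded hCσ hσ hc₀.le hr0 hn hK ht
    (fun j => (P j).eval t) (fun j hj => hPb j hj t ht)
  rw [← hCt] at htele
  have hsum : |splineNet φ θ ρ n c τ - ((P 0).eval t + ∑ j ∈ Finset.range n,
      ((P (j + 1)).eval t - (P j).eval t) * φ (ρ⁻¹ ^ 2 * t - ρ⁻¹ ^ 2 * (((j : ℝ) + 1) / n)))|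
      ≤ (Cl + Cu) * ρ + n * ((Cp + Cu + Q) * ρ) := by
    rw [splineNet, add_sub_add_comm, ← Finset.sum_sub_distrib]
    refine (abs_add_le _ _).trans (add_le_add hfirst ?_)
    refine (Finset.abs_sum_le_sum_abs _ _).trans ((Finset.sum_le_sum hjump).trans ?_)
    simp
  have hn1 : n * ((Cp + Cu + Q) * ρ) = (Cp + Cu + Q) * (n : ℝ) ^ (-r) := by rw [← hnρ]; ring
  have hn2 : (Cl + Cu) * ρ ≤ (Cl + Cu) * (n : ℝ) ^ (-r) := by gcongr
  have hn3 : 0 ≤ Cu * (n : ℝ) ^ (-r) := by positivity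
  rw [hn1] at hsum
  rw [abs_le] at hsum htele ⊢
  constructor <;> linarith [hsum.1, hsum.2, htele.1, htele.2]

/-- The largest weights sit in the squared norm nets: accuracy `ρ^(s+3)` costs `ρ^(-3(s+3))` and the
step slope another `ρ^(-2)`, together the exponent `3 s + 11`. -/
lemma splineNet_mem_treeNets {φ : ℝ → ℝ} {d s n : ℕ} (hn : 1 ≤ n) {θ ρ C₁ C B : ℝ} (hρ0 : 0 < ρ)
    (hρ1 : ρ ≤ 1) (hnρ : (n : ℝ) ≤ ρ⁻¹) {τ : EuclideanSpace ℝ (Fin d) → ℝ}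
    (hC₁ : 1 ≤ C₁) (hτ : ∀ lam : ℝ, C₁ * (ρ ^ (s + 3))⁻¹ ^ 3 * |lam| ≤ B →
      (fun x => lam * τ x) ∈ treeNets d (radialWidths d s n) (fun _ => φ) B 1)
    {c : ℕ → Fin (s + 1) → ℝ} (hC : 1 ≤ C) (hc : ∀ j i, |c j i| ≤ C * ρ⁻¹ ^ s)
    (hB : (C₁ * (s + 1) + C + |θ| + |iteratedDeriv 1 φ θ|⁻¹ + |iteratedDeriv 2 φ θ|⁻¹)
      * ρ⁻¹ ^ (3 * s + 11) ≤ B) :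
    (fun x => splineNet φ θ ρ n c (τ x))
      ∈ treeNets d (radialWidths d s n) (fun _ => φ) B 3 := by
  set D₁ := iteratedDeriv 1 φ θ with hD₁
  set D₂ := iteratedDeriv 2 φ θ with hD₂
  have hq : 1 ≤ ρ⁻¹ := (one_le_inv₀ hρ0).2 hρ1
  have hn0 : (0 : ℝ) < n := by exact_mod_cast hn
  have hpos1 : 0 ≤ C₁ * (s + 1) := by positivity
  have hpos2 := abs_nonneg θ
  have hpos3 : 0 ≤ |D₁|⁻¹ := by positivity
  have hpos4 : 0 ≤ |D₂|⁻¹ := by positivity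
  have hbd : ∀ (a z : ℝ) (k : ℕ), k ≤ 3 * s + 11 → 0 ≤ a →
      a ≤ C₁ * (s + 1) + C + |θ| + |D₁|⁻¹ + |D₂|⁻¹ → z ≤ a * ρ⁻¹ ^ k → z ≤ B := by
    intro a z k hk ha hle hz
    refine hz.trans (le_trans ?_ hB)
    have := pow_le_pow_right₀ hq hk
    gcongr
  have hB0 : 0 ≤ B := hbd 0 0 0 (by omega) le_rfl (by linarith) (by simp)
  have hlam : ∀ lam : ℝ, |lam| ≤ (s + 1) * ρ⁻¹ ^ 2 →
      (fun x => lam * τ x) ∈ treeNets d (radialWidths d s n) (fun _ => φ) B 1 := by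
    intro lam h
    refine hτ lam (hbd (C₁ * (s + 1)) _ (3 * s + 11) le_rfl hpos1 (by linarith) ?_)
    calc C₁ * (ρ ^ (s + 3))⁻¹ ^ 3 * |lam| ≤ C₁ * (ρ ^ (s + 3))⁻¹ ^ 3 * ((s + 1) * ρ⁻¹ ^ 2) := by
          gcongr
      _ = C₁ * (s + 1) * ρ⁻¹ ^ (3 * s + 11) := by
          rw [← inv_pow]; ring
  have hq2 : 1 ≤ ρ⁻¹ ^ 2 := one_le_pow₀ hq
  have hs0 : (0 : ℝ) ≤ s := Nat.cast_nonneg s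
  have hnode : ∀ (a b e : ℝ) (j : ℕ), |a| ≤ 1 → |b| ≤ 1 → |e| ≤ 1 →
      (fun x => a * polyNode φ θ ρ (c j) (τ x) + b * stepNode φ ρ e (τ x))
        ∈ treeNets d (radialWidths d s n) (fun _ => φ) B 2 := by
    intro a b e j ha hb he
    refine two_layer_mem_treeNets hB0 (by simp [radialWidths]) (fun i => hlam _ ?_) (hlam _ ?_)
      (fun i => ?_) ?_ ?_ ?_
    · have hi : ((i : ℕ) : ℝ) ≤ s := by exact_mod_cast Nat.lt_succ_iff.1 i.2
      rw [abs_of_nonneg (by positivity)]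
      have : ((i : ℕ) : ℝ) * ρ ≤ s * 1 := by gcongr
      nlinarith
    · rw [abs_of_pos (by positivity)]
      nlinarith
    · refine hbd C _ s (by omega) (by linarith) (by linarith) ?_
      rw [abs_mul]
      have := hc j i
      nlinarith [abs_nonneg (c j i)]
    · exact hbd 1 _ 0 (by omega) zero_le_one (by linarith) (by simpa using hb)
    · exact hbd |θ| _ 0 (by omega) hpos2 (by linarith) (by simp)
    · refine hbd 1 _ 2 (by omega) zero_le_one (by linarith) ?_
      rw [abs_mul, abs_of_pos (by positivity : 0 < ρ⁻¹ ^ 2)]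
      nlinarith
  have hρa : |ρ| ≤ 1 := by rwa [abs_of_pos hρ0]
  have hknot : ∀ j : Fin n, |(((j : ℕ) : ℝ) + 1) / n| ≤ 1 := by
    intro j
    have : ((j : ℕ) : ℝ) + 1 ≤ n := by exact_mod_cast j.2
    rw [abs_of_nonneg (by positivity)]
    exact (div_le_one hn0).2 this
  set A₁ := (ρ * D₁)⁻¹ with hA₁
  set A₂ := (ρ ^ 2 * D₂)⁻¹ with hA₂
  have hA₁b : |A₁| = |D₁|⁻¹ * ρ⁻¹ := by
    rw [hA₁, abs_inv, abs_mul, abs_of_pos hρ0, mul_inv, mul_comm]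
  have hA₂b : |A₂| = |D₂|⁻¹ * ρ⁻¹ ^ 2 := by
    rw [hA₂, abs_inv, abs_mul, abs_of_pos (by positivity : 0 < ρ ^ 2), mul_inv, mul_comm, inv_pow]
  have hA₂B : |A₂| ≤ B := hbd |D₂|⁻¹ _ 2 (by omega) hpos4 (by linarith) hA₂b.le
  have hA₁B : |A₁| ≤ B := hbd |D₁|⁻¹ _ 1 (by omega) hpos3 (by linarith) (by rw [hA₁b, pow_one])
  -- All the constants `φ θ` of the finite differences are gathered in a single node.
  have hconst : |n * A₂ - A₁| ≤ B := by
    refine hbd (|D₂|⁻¹ + |D₁|⁻¹) _ 3 (by omega) (by positivity) (by linarith) ?_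
    refine (abs_sub _ _).trans ?_
    rw [abs_mul, Nat.abs_cast, hA₁b, hA₂b]
    have h1 : n * (|D₂|⁻¹ * ρ⁻¹ ^ 2) ≤ ρ⁻¹ * (|D₂|⁻¹ * ρ⁻¹ ^ 2) := by gcongr
    have h2 : |D₁|⁻¹ * ρ⁻¹ ≤ |D₁|⁻¹ * ρ⁻¹ ^ 3 := by
      gcongr
      exact le_self_pow₀ hq (by norm_num)
    nlinarith
  have hθB : |θ| ≤ B := hbd |θ| _ 0 (by omega) hpos2 (by linarith) (by simp)
  -- Three nodes per jump, one for the first piece and one for the constant: `3 n + 2 ≤ 3 n + 3`.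
  have hmem := sum_mem_treeNets_succ (φ := fun _ => φ) (N := radialWidths d s n) (k := 2)
    (ι := (Fin n × Fin 3) ⊕ Fin 2) hB0 (by simp [radialWidths]; omega)
    (a := Sum.elim (fun p => ![A₂, -A₂, -A₂] p.2) ![A₁, n * A₂ - A₁])
    (b := fun _ => θ)
    (H := Sum.elim
      (fun p => ![
        fun x => ρ * polyNode φ θ ρ (c (p.1 + 1)) (τ x)
          + ρ * stepNode φ ρ ((((p.1 : ℕ) : ℝ) + 1) / n) (τ x),
        fun x => ρ * polyNode φ θ ρ (c (p.1 + 1)) (τ x) + 0 * stepNode φ ρ 0 (τ x),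
        fun x => 0 * polyNode φ θ ρ (c 0) (τ x)
          + ρ * stepNode φ ρ ((((p.1 : ℕ) : ℝ) + 1) / n) (τ x)] p.2)
      ![fun x => ρ * polyNode φ θ ρ (c 0) (τ x) + 0 * stepNode φ ρ 0 (τ x), fun _ => 0])
    (fun i => by
      rcases i with ⟨j, i⟩ | i
      · fin_cases i <;> simpa using hA₂B
      · fin_cases i
        · exact hA₁B
        · exact hconst)
    (fun _ => hθB)
    (fun i => by
      rcases i with ⟨j, i⟩ | i
      · fin_cases i
        · exact hnode _ _ _ _ hρa hρa (hknot j)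
        · exact hnode _ _ _ _ hρa (by simp) (by simp)
        · exact hnode _ _ _ _ (by simp) hρa (hknot j)
      · fin_cases i
        · exact hnode _ _ _ _ hρa (by simp) (by simp)
        · exact zero_mem_treeNets d _ _ hB0 2)
  convert hmem using 1
  funext x
  rw [Fintype.sum_sum_type, Fintype.sum_prod_type]
  simp only [Fin.sum_univ_three, Fin.sum_univ_two, Sum.elim_inl, Sum.elim_inr, Matrix.cons_val_zero,
    Matrix.cons_val_one, Matrix.cons_val, zero_mul, add_zero, zero_add]
  have hsum : ∑ j : Fin n, (φ (ρ * (polyNode φ θ ρ (c (j + 1)) (τ x)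
        + stepNode φ ρ (((j : ℕ) + 1) / n) (τ x)) + θ)
        - φ (ρ * polyNode φ θ ρ (c (j + 1)) (τ x) + θ)
        - φ (ρ * stepNode φ ρ (((j : ℕ) + 1) / n) (τ x) + θ) + φ θ) / (ρ ^ 2 * D₂)
      = ∑ j : Fin n, (A₂ * φ (ρ * polyNode φ θ ρ (c (j + 1)) (τ x)
        + ρ * stepNode φ ρ (((j : ℕ) + 1) / n) (τ x) + θ)
        + -A₂ * φ (ρ * polyNode φ θ ρ (c (j + 1)) (τ x) + θ)
        + -A₂ * φ (ρ * stepNode φ ρ (((j : ℕ) + 1) / n) (τ x) + θ)) + n * (A₂ * φ θ) := by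
    rw [show (n : ℝ) * (A₂ * φ θ) = ∑ _j : Fin n, A₂ * φ θ by simp, ← Finset.sum_add_distrib]
    refine Finset.sum_congr rfl fun j _ => ?_
    rw [div_eq_mul_inv, ← hA₂, mul_add ρ]
    ring
  rw [splineNet, Finset.sum_range, hsum, div_eq_mul_inv, ← hA₁]
  ring

/-! ### The upper bound and the conclusion. -/

lemma exists_net_approx {φ : ℝ → ℝ} (hφ : IsSmoothSigmoidal φ) (d : ℕ) (hd : 0 < d) (s : ℕ)
    (v r c₀ M : ℝ) (hv₀ : 0 < v) (hr : r = s + v) (hc₀ : 0 < c₀) (hM : 0 < M) :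
    ∃ C : ℝ, 1 ≤ C ∧ ∀ (n : ℕ) (B : ℝ), 1 ≤ n → C * (n : ℝ) ^ ((r + 1) * (3 * s + 11)) ≤ B →
      ∀ f ∈ radialLipBdd d s v c₀ M, ∃ h ∈ treeNets d (radialWidths d s n) (fun _ => φ) B 3,
        ∀ x ∈ Metric.closedBall (0 : EuclideanSpace ℝ (Fin d)) 1,
          |f x - h x| ≤ C * (n : ℝ) ^ (-r) := by
  obtain ⟨θ, hθ⟩ := hφ.nonvanishing
  obtain ⟨C₁, hC₁, hsq⟩ := exists_norm_sq_net hφ θ (hθ 1) (hθ 2) d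
  obtain ⟨C₂, hC₂, happ⟩ := exists_splineNet_approx hφ θ hθ s v r c₀ M hv₀ hr hc₀ hM
  have hr0 : 0 < r := by rw [hr]; positivity
  set C := C₁ * (s + 1) + C₂ + |θ| + |iteratedDeriv 1 φ θ|⁻¹ + |iteratedDeriv 2 φ θ|⁻¹ with hC
  have hCC₂ : C₁ + C₂ ≤ C := by
    have : 0 ≤ C₁ * s := by positivity
    have : 0 ≤ |θ| + |iteratedDeriv 1 φ θ|⁻¹ + |iteratedDeriv 2 φ θ|⁻¹ := by positivity
    linarith
  refine ⟨C, by linarith, fun n B hn hB f hf => ?_⟩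
  obtain ⟨⟨g, hg, hfg⟩, hfM⟩ := hf
  have hnR : (1 : ℝ) ≤ n := by exact_mod_cast hn
  have hn0 : (0 : ℝ) < n := by linarith
  obtain ⟨ρ, hρ⟩ : ∃ ρ : ℝ, ρ = (n : ℝ) ^ (-(r + 1)) := ⟨_, rfl⟩
  have hρ0 : 0 < ρ := by rw [hρ]; positivity
  have hρ1 : ρ ≤ 1 := by
    rw [hρ]; exact Real.rpow_le_one_of_one_le_of_nonpos hnR (by linarith)
  have hinv : ρ⁻¹ = (n : ℝ) ^ (r + 1) := by rw [hρ, Real.rpow_neg hn0.le, inv_inv]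
  have hpow : ρ⁻¹ ^ (3 * s + 11) = (n : ℝ) ^ ((r + 1) * (3 * s + 11)) := by
    rw [hinv, ← Real.rpow_mul_natCast hn0.le]
    push_cast
    rfl
  have hgM : ∀ t ∈ Set.Icc (0 : ℝ) 1, |g t| ≤ M := by
    intro t ht
    obtain ⟨x, hx⟩ := exists_norm_sq_eq hd ht.1
    have hxB : x ∈ Metric.closedBall (0 : EuclideanSpace ℝ (Fin d)) 1 := by
      rw [mem_closedBall_zero_iff]
      nlinarith [norm_nonneg x, ht.2]
    have := hfM x hxB
    rwa [hfg x hxB, hx] at this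
  obtain ⟨c, hc, hcb⟩ := happ n ρ hn hρ g hg hgM
  obtain ⟨τ, hτ, hτN⟩ := hsq (ρ ^ (s + 3)) (by positivity) (pow_le_one₀ hρ0.le hρ1)
  have hBC : C₁ ≤ B := by
    have h1 : 1 ≤ (n : ℝ) ^ ((r + 1) * (3 * s + 11)) := Real.one_le_rpow hnR (by positivity)
    nlinarith
  have hmem := splineNet_mem_treeNets (φ := φ) (d := d) (s := s) (n := n) (θ := θ) (ρ := ρ)
    (C₁ := C₁) (C := C₂) (B := B) hn hρ0 hρ1
    (by
      rw [hinv]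
      exact Real.self_le_rpow_of_one_le hnR (by linarith))
    (τ := τ) hC₁ (fun lam h => hτN _ B lam (by simp [radialWidths]) hBC h) hC₂ hc
    (by rw [hpow]; exact hB)
  refine ⟨_, hmem, fun x hx => ?_⟩
  have hx1 : ‖x‖ ≤ 1 := by simpa using hx
  rw [hfg x hx, abs_sub_comm]
  refine (hcb (‖x‖ ^ 2) ⟨by positivity, pow_le_one₀ (norm_nonneg x) hx1⟩ _ (hτ x hx)).trans ?_
  gcongr
  linarith

lemma deviation_le_ofReal {d : ℕ} {U V : Set (EuclideanSpace ℝ (Fin d) → ℝ)} {ε : ℝ}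
    (h : ∀ f ∈ U, ∃ g ∈ V, ∀ x ∈ Metric.closedBall (0 : EuclideanSpace ℝ (Fin d)) 1,
      |f x - g x| ≤ ε) : deviation U V ∞ ≤ ENNReal.ofReal ε := by
  refine iSup₂_le fun f hf => ?_
  obtain ⟨g, hg, hfg⟩ := h f hf
  refine (iInf₂_le g hg).trans ?_
  rw [eLpNorm_exponent_top]
  refine eLpNormEssSup_le_of_ae_bound ?_
  rw [ae_restrict_iff' Metric.isClosed_closedBall.measurableSet]
  exact Filter.Eventually.of_forall hfg

lemma deviation_mono_left {d : ℕ} {U U' V : Set (EuclideanSpace ℝ (Fin d) → ℝ)} {p : ℝ≥0∞}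
    (h : U ⊆ U') : deviation U V p ≤ deviation U' V p :=
  biSup_mono fun _ hf => h hf

lemma exists_upper_bound {φ : ℝ → ℝ} (hφ : IsSmoothSigmoidal φ) (d : ℕ) (hd : 0 < d) (s : ℕ)
    (v r c₀ : ℝ) (hv₀ : 0 < v) (hr : r = s + v) (hc₀ : 0 < c₀) (R : ℝ) (hR : 1 ≤ R) (α : ℝ)
    (hα : (r + 1) * (3 * s + 11) + 1 ≤ α) (M : ℝ) (hM : 0 < M) :
    ∃ C₃ : ℝ, 0 < C₃ ∧ ∀ n : ℕ, 2 ≤ n → deviation (radialLipBdd d s v c₀ M)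
      (boundedTreeNets d (radialWidths d s n) (fun _ => φ) 3 α R) ∞
        ≤ ENNReal.ofReal (C₃ * (n : ℝ) ^ (-r)) := by
  obtain ⟨C, hC1, hC⟩ := exists_net_approx hφ d hd s v r c₀ M hv₀ hr hc₀ hM
  obtain ⟨c', -, hT⟩ := treeParamCount_radialWidths_bounds d s
  have hr0 : 0 < r := by rw [hr]; positivity
  -- For `n ≥ C` the `+ 1` in `hα` absorbs `C` into the parameter bound; for `n ≤ C` the zero net
  -- suffices, since `M ≤ M C^r n^(-r)`.
  refine ⟨C + M * C ^ r, by positivity, fun n hn => deviation_le_ofReal fun f hf => ?_⟩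
  have hnR : (2 : ℝ) ≤ n := by exact_mod_cast hn
  have hn0 : (0 : ℝ) < n := by linarith
  have hTn : (n : ℝ) ≤ treeParamCount (radialWidths d s n) 3 := by
    exact_mod_cast (hT n (by omega)).1
  set T := treeParamCount (radialWidths d s n) 3 with hTdef
  have hα0 : 0 ≤ α := by
    have : 0 ≤ (r + 1) * (3 * s + 11) := by positivity
    linarith
  rcases le_total C n with hCn | hCn
  · have hB : C * (n : ℝ) ^ ((r + 1) * (3 * s + 11)) ≤ R * (T : ℝ) ^ α := by
      calc C * (n : ℝ) ^ ((r + 1) * (3 * s + 11)) ≤ n * (n : ℝ) ^ ((r + 1) * (3 * s + 11)) := by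
            gcongr
        _ = (n : ℝ) ^ ((r + 1) * (3 * s + 11) + 1) := by
            rw [Real.rpow_add_one hn0.ne', mul_comm]
        _ ≤ (n : ℝ) ^ α := Real.rpow_le_rpow_of_exponent_le (by linarith) hα
        _ ≤ (T : ℝ) ^ α := by gcongr
        _ ≤ R * (T : ℝ) ^ α := le_mul_of_one_le_left (by positivity) hR
    obtain ⟨h, hh, hfh⟩ := hC n _ (by omega) hB f hf
    refine ⟨h, hh, fun x hx => (hfh x hx).trans ?_⟩
    gcongr
    exact le_add_of_nonneg_right (by positivity)
  · refine ⟨fun _ => 0, zero_mem_treeNets d _ _ (by positivity) 3, fun x hx => ?_⟩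
    rw [sub_zero]
    refine (hf.2 x hx).trans ?_
    have h1 : 1 ≤ C ^ r * (n : ℝ) ^ (-r) := by
      rw [Real.rpow_neg hn0.le, ← div_eq_mul_inv, one_le_div (by positivity)]
      gcongr
    have h2 : 0 ≤ C * (n : ℝ) ^ (-r) := by positivity
    nlinarith

theorem theorem2
    (d : ℕ) (hd : 2 ≤ d)
    (φ : ℝ → ℝ) (hφ : IsSmoothSigmoidal φ)
    (s : ℕ) (v r : ℝ) (hv₀ : 0 < v) (hv₁ : v ≤ 1) (hr : r = s + v)
    (c₀ : ℝ) (hc₀ : 0 < c₀)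
    (R : ℝ) (hR : 1 ≤ R)
    (α : ℝ)
    (hα : α = 48 * (3 + r * (r + 1) + r * (Nat.factorial (s + 1) : ℝ) * 7 * (r + 1))) :
    -- the lower bound for the whole class
    (∃ C₂ : ℝ, 0 < C₂ ∧ ∀ n : ℕ, 2 ≤ n →
      ENNReal.ofReal ((9 : ℝ) ^ (-r) * C₂ * ((n : ℝ) * Real.log n) ^ (-r))
        ≤ deviation (radialLip d s v c₀)
            (boundedTreeNets d (radialWidths d s n) (fun _ => φ) 3 α R) ∞) ∧
    -- both bounds, uniformly over the functions of the class that are bounded by `M`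
    (∀ M : ℝ, 0 < M → ∃ C₂ C₃ : ℝ, 0 < C₂ ∧ 0 < C₃ ∧ ∀ n : ℕ, 2 ≤ n →
      ENNReal.ofReal ((9 : ℝ) ^ (-r) * C₂ * ((n : ℝ) * Real.log n) ^ (-r))
        ≤ deviation (radialLipBdd d s v c₀ M)
            (boundedTreeNets d (radialWidths d s n) (fun _ => φ) 3 α R) ∞ ∧
      deviation (radialLipBdd d s v c₀ M)
            (boundedTreeNets d (radialWidths d s n) (fun _ => φ) 3 α R) ∞
        ≤ ENNReal.ofReal (C₃ * (n : ℝ) ^ (-r))) := by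
  have hr0 : 0 < r := by rw [hr]; positivity
  have hd0 : 0 < d := by omega
  have hf : 0 ≤ r * (Nat.factorial (s + 1) : ℝ) * 7 * (r + 1) := by positivity
  -- With `s ≤ r`, the part `48 (3 + r (r + 1))` of `α` already dominates.
  have hα1 : (r + 1) * (3 * s + 11) + 1 ≤ α := by
    have hs : (s : ℝ) ≤ r := by linarith
    have : (r + 1) * (3 * (s : ℝ) + 11) ≤ (r + 1) * (3 * r + 11) := by gcongr
    nlinarith
  have hα0 : 0 ≤ α := by
    have : 0 ≤ (r + 1) * (3 * (s : ℝ) + 11) := by positivity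
    linarith
  have hlow := exists_lower_bound d hd0 φ hφ s v r c₀ hv₀ hv₁ hr hc₀ R hR α hα0
  refine ⟨?_, fun M hM => ?_⟩
  -- The whole class contains the functions bounded by `1`, and the deviation is monotone in the
  -- target class.
  · obtain ⟨C₂, hC₂, h⟩ := hlow 1 one_pos
    exact ⟨C₂, hC₂, fun n hn => (h n hn).trans (deviation_mono_left fun _ hf => hf.1)⟩
  · obtain ⟨C₂, hC₂, h₂⟩ := hlow M hM
    obtain ⟨C₃, hC₃, h₃⟩ := exists_upper_bound hφ d hd0 s v r c₀ hv₀ hr hc₀ R hR α hα1 M hM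
    exact ⟨C₂, C₃, hC₂, hC₃, fun n hn => ⟨h₂ n hn, h₃ n hn⟩⟩
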